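/- Fix a prime $p$. Let $W$ be the ring scheme of $p$-typical Witt vectors, with the usual coordinates $x_0,x_1,\dots$. A scheme $S$ is called $p$-nilpotent if $p\in H^0(S,\mathcal O_S)$ is locally nilpotent. Let $W_{\mathrm{prim}}$ be the formal completion of $W$ along the locally closed subscheme given by $p=x_0=0$, $x_1\neq 0$: if $S$ is $p$-nilpotent then $W_{\mathrm{prim}}(S)$ is the set of all $(x_0,x_1,\dots)\in W(S)$ with $x_0$ locally nilpotent and $x_1$ invertible, and if $S$ is not $p$-nilpotent then $W_{\mathrm{prim}}(S)=\emptyset$. Let $\Sigma:=W_{\mathrm{prim}}/W^\times$ be the quotient stack of groupoids on the category of schemes with the fpqc topology: for $p$-nilpotent $S$, an object of $\Sigma(S)$ is a $W^\times$-torsor $P$ over $S$ together with a $W^\times$-equivariant morphism $\xi:P\to W_{\mathrm{prim}}$, and $\Sigma(S)=\emptyset$ if $S$ is not $p$-nilpotent. Let $p:\operatorname{Spf}\mathbb Z_p\to\Sigma$ be the composition of the morphism $\operatorname{Spf}\mathbb Z_p\to W_{\mathrm{prim}}$ given by the element $p\in W(\mathbb Z_p)$ and the quotient morphism $W_{\mathrm{prim}}\to\Sigma$.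 A closed substack $\mathscr Y\subset\Sigma$ consists of strictly full subcategories $\mathscr Y(S)\subset\Sigma(S)$, stable under base change and local for the fpqc topology, such that for every scheme $S$ and every morphism $S\to\Sigma$ the fiber product $\mathscr Y\times_\Sigma S$ is a closed subscheme of $S$. The ring $H^0(\Sigma,\mathcal O_\Sigma)$ is the ring of global functions on $\Sigma$, i.e. of collections of elements $s_x\in H^0(S,\mathcal O_S)$, for all schemes $S$ and all $x\in\Sigma(S)$, compatible with isomorphisms and base change. Then: (1) if $\mathscr Y\subset\Sigma$ is a closed substack such that the morphism $p:\operatorname{Spf}\mathbb Z_p\to\Sigma$ factors through $\mathscr Y$, then $\mathscr Y=\Sigma$; (2) the canonical homomorphism $\mathbb Z_p\to H^0(\Sigma,\mathcal O_\Sigma)$ is an isomorphism. -/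

import Mathlib

universe u

open CategoryTheory AlgebraicGeometry Opposite

noncomputable section

namespace Prismatization

/-! ### Locally nilpotent functions and `p`-nilpotent schemes -/

/-- A global function on a scheme is locally nilpotent if every point has an open neighbourhood
on which the function becomes nilpotent. -/
def IsLocallyNilpotent {S : Scheme.{u}} (s : Γ(S, ⊤)) : Prop :=
  ∀ x : S, ∃ U : S.Opens, x ∈ U ∧ IsNilpotent (S.presheaf.map (homOfLE (le_top : U ≤ ⊤)).op s)

/-- A scheme `S` is `p`-nilpotent if `p ∈ H⁰(S, 𝒪_S)` is locally nilpotent. -/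
def IsPNilpotent (p : ℕ) (S : Scheme.{u}) : Prop :=
  IsLocallyNilpotent (p : Γ(S, ⊤))

lemma IsLocallyNilpotent.appTop {S T : Scheme.{u}} (f : T ⟶ S) {s : Γ(S, ⊤)}
    (hs : IsLocallyNilpotent s) : IsLocallyNilpotent (f.appTop s) := by
  intro x
  obtain ⟨U, hxU, hU⟩ := hs (f x)
  refine ⟨f ⁻¹ᵁ U, hxU, ?_⟩
  have := hU.map (f.app U).hom
  convert this using 1
  have h := f.naturality (homOfLE (le_top : U ≤ ⊤)).op
  exact (ConcreteCategory.congr_hom h s).symm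

lemma IsLocallyNilpotent.add {S : Scheme.{u}} {s t : Γ(S, ⊤)} (hs : IsLocallyNilpotent s)
    (ht : IsLocallyNilpotent t) : IsLocallyNilpotent (s + t) := by
  intro x
  obtain ⟨U, hxU, hU⟩ := hs x
  obtain ⟨V, hxV, hV⟩ := ht x
  refine ⟨U ⊓ V, ⟨hxU, hxV⟩, ?_⟩
  have h1 := hU.map (S.presheaf.map (homOfLE (inf_le_left : U ⊓ V ≤ U)).op).hom
  have h2 := hV.map (S.presheaf.map (homOfLE (inf_le_right : U ⊓ V ≤ V)).op).hom
  have e1 : (S.presheaf.map (homOfLE (inf_le_left : U ⊓ V ≤ U)).op).hom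
      (S.presheaf.map (homOfLE (le_top : U ≤ ⊤)).op s) =
      S.presheaf.map (homOfLE (le_top : U ⊓ V ≤ ⊤)).op s := by
    rw [← ConcreteCategory.comp_apply, ← Functor.map_comp]; rfl
  have e2 : (S.presheaf.map (homOfLE (inf_le_right : U ⊓ V ≤ V)).op).hom
      (S.presheaf.map (homOfLE (le_top : V ≤ ⊤)).op t) =
      S.presheaf.map (homOfLE (le_top : U ⊓ V ≤ ⊤)).op t := by
    rw [← ConcreteCategory.comp_apply, ← Functor.map_comp]; rfl
  rw [e1] at h1
  rw [e2] at h2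
  rw [map_add]
  exact (Commute.all _ _).isNilpotent_add h1 h2

lemma IsLocallyNilpotent.mul_left {S : Scheme.{u}} {s : Γ(S, ⊤)} (t : Γ(S, ⊤))
    (hs : IsLocallyNilpotent s) : IsLocallyNilpotent (t * s) := by
  intro x
  obtain ⟨U, hxU, hU⟩ := hs x
  refine ⟨U, hxU, ?_⟩
  rw [map_mul]
  exact (Commute.all _ _).isNilpotent_mul_left hU

lemma IsLocallyNilpotent.isUnit_add {S : Scheme.{u}} {s t : Γ(S, ⊤)}
    (hs : IsLocallyNilpotent s) (ht : IsUnit t) : IsUnit (t + s) := by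
  refine S.toLocallyRingedSpace.toRingedSpace.isUnit_of_isUnit_germ ⊤ _ fun x hx => ?_
  rw [map_add]
  obtain ⟨U, hxU, hU⟩ := hs x
  have h1 : IsNilpotent (S.presheaf.germ ⊤ x hx s) := by
    have := hU.map (S.presheaf.germ U x hxU).hom
    convert this using 1
    exact (TopCat.Presheaf.germ_res_apply S.presheaf (homOfLE le_top) x hxU s).symm
  exact h1.isUnit_add_left_of_commute (ht.map (S.presheaf.germ ⊤ x hx).hom) (Commute.all _ _)

lemma IsPNilpotent.of_hom {p : ℕ} {S T : Scheme.{u}} (f : T ⟶ S) (hS : IsPNilpotent p S) :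
    IsPNilpotent p T := by
  have := hS.appTop f
  rwa [map_natCast] at this

/-! ### The canonical homomorphism from the `p`-adic integers -/

section PadicHom

variable (p : ℕ) [Fact p.Prime]

lemma padicInt_hom_ext {R : Type*} [CommRing R] (hp : IsNilpotent (p : R))
    (f g : ℤ_[p] →+* R) : f = g := by
  obtain ⟨n, hn⟩ := hp
  ext a
  have key : ∀ h : ℤ_[p] →+* R, h a = ((a.appr n : ℕ) : R) := by
    intro h
    obtain ⟨b, hb⟩ := Ideal.mem_span_singleton.mp (PadicInt.appr_spec n a)
    have : a = (a.appr n : ℤ_[p]) + (p : ℤ_[p]) ^ n * b := by rw [← hb]; ring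
    conv_lhs => rw [this]
    simp [hn]
  rw [key f, key g]

lemma exists_padicInt_hom {R : Type*} [CommRing R] (hp : IsNilpotent (p : R)) :
    Nonempty (ℤ_[p] →+* R) := by
  obtain ⟨n, hn⟩ := hp
  have : ringChar R ∣ p ^ n := ringChar.dvd (by exact_mod_cast hn)
  exact ⟨(ZMod.castHom this R).comp (PadicInt.toZModPow n)⟩

lemma padicInt_hom_sections_ext {S : Scheme.{u}} (hS : IsPNilpotent p S)
    (f g : ℤ_[p] →+* Γ(S, ⊤)) : f = g := by
  choose U hxU hU using hS
  ext a
  refine S.sheaf.eq_of_locally_eq' U ⊤ (fun x => homOfLE le_top)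
    (fun x _ => TopologicalSpace.Opens.mem_iSup.mpr ⟨x, hxU x⟩) _ _ fun x => ?_
  have hp := hU x
  rw [map_natCast] at hp
  exact congrArg (fun h : ℤ_[p] →+* Γ(S, U x) => h a) (padicInt_hom_ext p hp
    ((S.presheaf.map (homOfLE (le_top : U x ≤ ⊤)).op).hom.comp f)
    ((S.presheaf.map (homOfLE (le_top : U x ≤ ⊤)).op).hom.comp g))

lemma exists_padicInt_hom_sections {S : Scheme.{u}} (hS : IsPNilpotent p S) :
    Nonempty (ℤ_[p] →+* Γ(S, ⊤)) := by
  choose U hxU hU using hS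
  have hp : ∀ x : S, IsNilpotent (p : Γ(S, U x)) := fun x => by
    have := hU x
    rwa [map_natCast] at this
  choose h _ using fun x => (exists_true_iff_nonempty.mpr (exists_padicInt_hom p (hp x)))
  have glue : ∀ a : ℤ_[p], ∃ s : Γ(S, ⊤), ∀ x,
      S.presheaf.map (homOfLE (le_top : U x ≤ ⊤)).op s = h x a := fun a => by
    obtain ⟨s, hs, -⟩ := S.sheaf.existsUnique_gluing' U ⊤ (fun x => homOfLE le_top)
      (fun x _ => TopologicalSpace.Opens.mem_iSup.mpr ⟨x, hxU x⟩) (fun x => h x a) (by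
        intro x y
        refine congrArg (fun k : ℤ_[p] →+* Γ(S, U x ⊓ U y) => k a) (padicInt_hom_ext p ?_
          ((S.presheaf.map (homOfLE (inf_le_left : U x ⊓ U y ≤ U x)).op).hom.comp (h x))
          ((S.presheaf.map (homOfLE (inf_le_right : U x ⊓ U y ≤ U y)).op).hom.comp (h y)))
        have := (hp x).map (S.presheaf.map (homOfLE (inf_le_left : U x ⊓ U y ≤ U x)).op).hom
        rwa [map_natCast] at this)
    exact ⟨s, hs⟩
  choose F hF using glue
  have ext : ∀ s t : Γ(S, ⊤), (∀ x, S.presheaf.map (homOfLE (le_top : U x ≤ ⊤)).op s =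
      S.presheaf.map (homOfLE (le_top : U x ≤ ⊤)).op t) → s = t := fun s t hst =>
    S.sheaf.eq_of_locally_eq' U ⊤ (fun x => homOfLE le_top)
      (fun x _ => TopologicalSpace.Opens.mem_iSup.mpr ⟨x, hxU x⟩) _ _ hst
  exact ⟨{
    toFun := F
    map_one' := ext _ _ fun x => by simp [hF]
    map_mul' := fun a b => ext _ _ fun x => by simp [hF]
    map_zero' := ext _ _ fun x => by simp [hF]
    map_add' := fun a b => ext _ _ fun x => by simp [hF] }⟩

/-- The canonical (in fact, the only) ring homomorphism `ℤ_p → H⁰(S, 𝒪_S)` for a `p`-nilpotent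
scheme `S`; it corresponds to the unique morphism from `S` to `Spf ℤ_p`. -/
def padicIntToSections {S : Scheme.{u}} (hS : IsPNilpotent p S) : ℤ_[p] →+* Γ(S, ⊤) :=
  (exists_padicInt_hom_sections p hS).some

end PadicHom

/-! ### Categories over the category of schemes

A stack is represented by its fibred category `q : 𝒳 ⥤ Scheme`, whose fibre over `S` is the groupoid
of `S`-points, and in which every morphism is cartesian: a morphism `x' ⟶ x` over
`f : S' ⟶ S` is the same as an isomorphism of `x'` with the pullback `f^* x`. -/

section FibredCategories

variable {𝒳 : Type*} [Category 𝒳] (q : 𝒳 ⥤ Scheme.{u})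

/-- A closed substack of a stack `q : 𝒳 ⥤ Scheme`. -/
structure ClosedSubstack where
  /-- The objects belonging to the substack. -/
  mem : ObjectProperty 𝒳
  /-- The substack is stable under isomorphisms and under base change. -/
  mem_of_hom : ∀ {x' x : 𝒳} (_ : x' ⟶ x), mem x → mem x'
  /-- Membership in the substack is local for the fpqc topology. -/
  mem_of_cover : ∀ (x : 𝒳) (R : Sieve (q.obj x)), R ∈ Scheme.fpqcTopology (q.obj x) →
    (∀ (x' : 𝒳) (g : x' ⟶ x), R (q.map g) → mem x') → mem x
  /-- For every scheme `S` and every `S`-point `x`, the fibre product of the substack with `S` is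
  a closed subscheme `Z` of `S`. -/
  closed : ∀ x : 𝒳, ∃ (Z : Scheme.{u}) (i : Z ⟶ q.obj x), IsClosedImmersion i ∧
    ∀ (x' : 𝒳) (g : x' ⟶ x), mem x' ↔ ∃ h : q.obj x' ⟶ Z, h ≫ i = q.map g

variable {q} in
/-- A morphism of stacks `F : 𝒴 ⟶ 𝒳` factors through the closed substack `Y` of `𝒳`. Since `Y` is
a strictly full substack, this means that `F` sends all objects to objects of `Y`. -/
def ClosedSubstack.FactorsThrough (Y : ClosedSubstack q) {𝒴 : Type*} [Category 𝒴]
    (F : 𝒴 ⥤ 𝒳) : Prop :=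
  ∀ y : 𝒴, Y.mem (F.obj y)

/-- The ring `H⁰(𝒳, 𝒪_𝒳)`: a global function on `𝒳` is a collection of functions
`s x ∈ H⁰(S, 𝒪_S)` for all schemes `S` and all `x ∈ 𝒳(S)`, compatible with isomorphisms and base
change. -/
def globalFunctions : Subring (∀ x : 𝒳, Γ(q.obj x, ⊤)) where
  carrier := {s | ∀ ⦃x' x : 𝒳⦄ (g : x' ⟶ x), (q.map g).appTop (s x) = s x'}
  mul_mem' {a b} ha hb x' x g := by simp [ha g, hb g]
  one_mem' x' x g := by simp
  add_mem' {a b} ha hb x' x g := by simp [ha g, hb g]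
  zero_mem' x' x g := by simp
  neg_mem' {a} ha x' x g := by simp [ha g]

/-- If the stack `𝒳` lies over `Spf ℤ_p`, i.e. if `𝒳(S)` is empty unless `S` is `p`-nilpotent,
this is the canonical homomorphism `ℤ_p → H⁰(𝒳, 𝒪_𝒳)`. -/
def padicIntToGlobalFunctions (p : ℕ) [Fact p.Prime] (hq : ∀ x, IsPNilpotent p (q.obj x)) :
    ℤ_[p] →+* globalFunctions q :=
  (RingHom.pi fun x => padicIntToSections p (hq x)).codRestrict (globalFunctions q)
    fun a x' x g => by
      have := padicInt_hom_sections_ext p (hq x')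
        ((q.map g).appTop.hom.comp (padicIntToSections p (hq x))) (padicIntToSections p (hq x'))
      exact congrArg (fun h => h a) this

end FibredCategories

/-- The formal scheme `Spf ℤ_p`, as a category over the category of schemes: it has
exactly one `S`-point if `S` is `p`-nilpotent, and none otherwise. -/
abbrev SpfZp (p : ℕ) := ObjectProperty.FullSubcategory (IsPNilpotent p : ObjectProperty Scheme.{u})

/-- The structure functor of `Spf ℤ_p`. -/
abbrev SpfZp.toScheme (p : ℕ) : SpfZp.{u} p ⥤ Scheme.{u} :=
  ObjectProperty.ι (IsPNilpotent p : ObjectProperty Scheme.{u})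

/-! ### The ring scheme of Witt vectors and the formal scheme of primitive Witt vectors -/

section Witt

variable (p : ℕ) [Fact p.Prime]

/-- The ring `W(S) = W(H⁰(S, 𝒪_S))` of `S`-points of the ring scheme `W` of `p`-typical Witt
vectors. -/
abbrev Witt (S : Scheme.{u}) : Type u := WittVector p Γ(S, ⊤)

variable {p}

/-- The pullback `W(S) → W(T)` along a morphism `f : T ⟶ S`. -/
def Witt.pullback {S T : Scheme.{u}} (f : T ⟶ S) : Witt p S →+* Witt p T :=
  WittVector.map f.appTop.hom

@[simp]
lemma Witt.pullback_coeff {S T : Scheme.{u}} (f : T ⟶ S) (x : Witt p S) (n : ℕ) :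
    (Witt.pullback f x).coeff n = f.appTop (x.coeff n) := rfl

@[simp]
lemma Witt.pullback_id {S : Scheme.{u}} (x : Witt p S) : Witt.pullback (𝟙 S) x = x := by
  ext n; simp

lemma Witt.pullback_comp {S T U : Scheme.{u}} (f : T ⟶ S) (g : U ⟶ T) (x : Witt p S) :
    Witt.pullback (g ≫ f) x = Witt.pullback g (Witt.pullback f x) := by
  ext n
  rw [Witt.pullback_coeff, Scheme.Hom.comp_appTop]
  rfl

/-- The pullback `W(S)ˣ → W(T)ˣ` along a morphism `f : T ⟶ S`. -/
abbrev Witt.pullbackUnits {S T : Scheme.{u}} (f : T ⟶ S) : (Witt p S)ˣ →* (Witt p T)ˣ :=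
  Units.map (Witt.pullback f).toMonoidHom

/-- The `S`-points of the formal scheme `W_prim` (the formal completion of `W` along the locally
closed subscheme `p = x₀ = 0`, `x₁ ≠ 0`): the Witt vectors `(x₀, x₁, …) ∈ W(S)` with `x₀` locally
nilpotent and `x₁` invertible, where `S` has to be `p`-nilpotent. -/
structure IsPrimitive {S : Scheme.{u}} (x : Witt p S) : Prop where
  isPNilpotent : IsPNilpotent p S
  coeff_zero : IsLocallyNilpotent (x.coeff 0)
  coeff_one : IsUnit (x.coeff 1)

lemma IsPrimitive.pullback {S T : Scheme.{u}} (f : T ⟶ S) {x : Witt p S} (hx : IsPrimitive x) :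
    IsPrimitive (Witt.pullback f x) where
  isPNilpotent := hx.isPNilpotent.of_hom f
  coeff_zero := hx.coeff_zero.appTop f
  coeff_one := hx.coeff_one.map f.appTop.hom

lemma witt_mul_coeff_one {R : Type u} [CommRing R] (x y : WittVector p R) :
    (x * y).coeff 1 = x.coeff 0 ^ p * y.coeff 1 + x.coeff 1 * y.coeff 0 ^ p +
      p * (x.coeff 1 * y.coeff 1) := by
  have hs : Function.Surjective (MvPolynomial.eval₂Hom (Int.castRingHom R) (id : R → R)) :=
    fun r => ⟨MvPolynomial.X r, by simp⟩
  obtain ⟨x, rfl⟩ := WittVector.map_surjective _ hs x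
  obtain ⟨y, rfl⟩ := WittVector.map_surjective _ hs y
  rw [← map_mul]
  simp only [WittVector.map_coeff]
  rw [← map_natCast (MvPolynomial.eval₂Hom (Int.castRingHom R) (id : R → R)) p]
  simp only [← map_mul, ← map_pow, ← map_add]
  congr 1
  have h := map_mul (WittVector.ghostComponent (p := p) (R := MvPolynomial R ℤ) 1) x y
  simp only [WittVector.ghostComponent_apply, aeval_wittPolynomial, Finset.sum_range_succ,
    Finset.sum_range_zero, WittVector.mul_coeff_zero] at h
  have hp : (p : MvPolynomial R ℤ) ≠ 0 := by
    exact_mod_cast (Fact.out : p.Prime).ne_zero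
  apply mul_left_cancel₀ hp
  simp at h
  linear_combination h

lemma witt_p_coeff_zero (R : Type u) [CommRing R] : (p : WittVector p R).coeff 0 = p :=
  map_natCast WittVector.constantCoeff p

lemma witt_p_coeff_one (R : Type u) [CommRing R] :
    (p : WittVector p R).coeff 1 = 1 - (p : R) ^ (p - 1) := by
  have hz : (p : WittVector p ℤ).coeff 1 = 1 - (p : ℤ) ^ (p - 1) := by
    have h := map_natCast (WittVector.ghostComponent (p := p) (R := ℤ) 1) p
    simp only [WittVector.ghostComponent_apply, aeval_wittPolynomial, Finset.sum_range_succ,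
      Finset.sum_range_zero] at h
    rw [show (p : WittVector p ℤ).coeff 0 = p from map_natCast WittVector.constantCoeff p] at h
    have hp : (p : ℤ) ≠ 0 := by
      exact_mod_cast (Fact.out : p.Prime).ne_zero
    apply mul_left_cancel₀ hp
    have h2 := pow_sub_one_mul (Fact.out : p.Prime).ne_zero (p : ℤ)
    simp at h
    linear_combination h + h2
  have := congrArg (Int.castRingHom R) hz
  rw [← WittVector.map_coeff, map_natCast] at this
  rw [this]
  simp

/-- `W_prim` is stable under multiplication by `W^×`. -/
lemma IsPrimitive.units_mul {S : Scheme.{u}} {x : Witt p S} (hx : IsPrimitive x)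
    (l : (Witt p S)ˣ) : IsPrimitive ((l : Witt p S) * x) where
  isPNilpotent := hx.isPNilpotent
  coeff_zero := by
    rw [WittVector.mul_coeff_zero]
    exact hx.coeff_zero.mul_left _
  coeff_one := by
    rw [witt_mul_coeff_one, add_assoc]
    refine IsLocallyNilpotent.isUnit_add ?_ ?_
    · refine IsLocallyNilpotent.add (IsLocallyNilpotent.mul_left _ ?_) ?_
      · rw [← pow_sub_one_mul (Fact.out : p.Prime).ne_zero]
        exact hx.coeff_zero.mul_left _
      · rw [mul_comm]
        exact IsLocallyNilpotent.mul_left _ hx.isPNilpotent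
    · exact ((l.isUnit.map WittVector.constantCoeff).pow p).mul hx.coeff_one

/-- The Witt vector `p` is primitive over every `p`-nilpotent scheme. -/
lemma isPrimitive_p {S : Scheme.{u}} (hS : IsPNilpotent p S) : IsPrimitive (p : Witt p S) where
  isPNilpotent := hS
  coeff_zero := by rw [witt_p_coeff_zero]; exact hS
  coeff_one := by
    rw [witt_p_coeff_one, sub_eq_add_neg]
    refine IsLocallyNilpotent.isUnit_add ?_ isUnit_one
    have h2 := (Fact.out : p.Prime).two_le
    obtain ⟨k, hk⟩ : ∃ k, p - 1 = k + 1 := ⟨p - 2, by omega⟩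
    rw [hk, pow_succ, ← neg_mul]
    exact IsLocallyNilpotent.mul_left _ hS

variable (p)

/-- The formal scheme `W_prim`, as a category over the category of schemes: an object is a scheme
together with an `S`-point of `W_prim`. -/
structure WPrim where
  /-- The test scheme. -/
  base : Scheme.{u}
  /-- The primitive Witt vector. -/
  val : Witt p base
  isPrimitive : IsPrimitive val

variable {p} in
/-- Morphisms of points of `W_prim` are morphisms of test schemes compatible with the points. -/
@[ext]
structure WPrim.Hom (x y : WPrim.{u} p) where
  /-- The morphism of test schemes. -/
  hom : x.base ⟶ y.base
  pullback_val : Witt.pullback hom y.val = x.val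

instance : Category (WPrim.{u} p) where
  Hom := WPrim.Hom
  id x := ⟨𝟙 x.base, Witt.pullback_id _⟩
  comp f g := ⟨f.hom ≫ g.hom, by rw [Witt.pullback_comp, g.pullback_val, f.pullback_val]⟩

/-- The morphism `Spf ℤ_p ⟶ W_prim` given by the element `p ∈ W(ℤ_p)`. -/
def pointP : SpfZp.{u} p ⥤ WPrim.{u} p where
  obj S := ⟨S.obj, (p : Witt p S.obj), isPrimitive_p S.property⟩
  map f := ⟨f.hom, map_natCast _ _⟩

/-! ### Torsors under `W^×` and the stack `Σ` -/

/-- A `W^×`-torsor over a scheme `S` (for the fpqc topology): an fpqc sheaf `P` of sets over `S` with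
an action of `W^×` along the fibres of `P ⟶ S` which is simply transitive, and such that
`P ⟶ S` has sections locally for the fpqc topology. -/
structure WittTorsor (S : Scheme.{u}) where
  /-- The underlying presheaf of sets on the category of schemes. -/
  P : Scheme.{u}ᵒᵖ ⥤ Type u
  isSheaf : Presieve.IsSheaf Scheme.fpqcTopology P
  /-- The structure morphism `P ⟶ S`. -/
  π : P ⟶ yoneda.obj S
  /-- The action of `W^×`. -/
  smul : ∀ {T : Scheme.{u}}, (Witt p T)ˣ → P.obj (op T) → P.obj (op T)
  one_smul : ∀ {T : Scheme.{u}} (a : P.obj (op T)), smul 1 a = a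
  mul_smul : ∀ {T : Scheme.{u}} (l m : (Witt p T)ˣ) (a : P.obj (op T)),
    smul (l * m) a = smul l (smul m a)
  map_smul : ∀ {T T' : Scheme.{u}} (f : T' ⟶ T) (l : (Witt p T)ˣ) (a : P.obj (op T)),
    P.map f.op (smul l a) = smul (Witt.pullbackUnits f l) (P.map f.op a)
  π_smul : ∀ {T : Scheme.{u}} (l : (Witt p T)ˣ) (a : P.obj (op T)),
    π.app (op T) (smul l a) = π.app (op T) a
  simply_transitive : ∀ {T : Scheme.{u}} (a b : P.obj (op T)),
    π.app (op T) a = π.app (op T) b → ∃! l : (Witt p T)ˣ, smul l a = b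
  locally_nonempty : ∃ R ∈ Scheme.fpqcTopology S, ∀ (T : Scheme.{u}) (f : T ⟶ S), R f →
    ∃ a : P.obj (op T), π.app (op T) a = f

/-- The stack `Σ = W_prim / W^×`, as a category over the category of schemes. Its
objects over a `p`-nilpotent scheme `S` are the pairs consisting of a `W^×`-torsor `P` over `S` and
a `W^×`-equivariant morphism `ξ : P ⟶ W_prim`. (The torsor `P` is the torsor of generators of an
invertible `W_S`-module `M`, and `ξ` is the restriction of a primitive `W_S`-linear morphism
`M ⟶ W_S`; so `W^×` acts on `W_prim` by multiplication here.) There are no objects over a scheme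
that is not `p`-nilpotent. -/
structure SigmaStack where
  /-- The test scheme `S`. -/
  base : Scheme.{u}
  isPNilpotent : IsPNilpotent p base
  /-- The torsor `P`. -/
  torsor : WittTorsor.{u} p base
  /-- The morphism `P ⟶ W_prim`. -/
  ξ : ∀ {T : Scheme.{u}}, torsor.P.obj (op T) → Witt p T
  ξ_isPrimitive : ∀ {T : Scheme.{u}} (a : torsor.P.obj (op T)), IsPrimitive (ξ a)
  ξ_map : ∀ {T T' : Scheme.{u}} (f : T' ⟶ T) (a : torsor.P.obj (op T)),
    ξ (torsor.P.map f.op a) = Witt.pullback f (ξ a)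
  ξ_smul : ∀ {T : Scheme.{u}} (l : (Witt p T)ˣ) (a : torsor.P.obj (op T)),
    ξ (torsor.smul l a) = (l : Witt p T) * ξ a

variable {p} in
/-- A morphism of `Σ` over a morphism of schemes `f : S ⟶ S'`: a `W^×`-equivariant map of torsors
`P ⟶ P'` over `f` (equivalently, an isomorphism of `P` with the pullback of `P'`) which
is compatible with the maps to `W_prim`. -/
@[ext]
structure SigmaStack.Hom (x y : SigmaStack.{u} p) where
  /-- The morphism of test schemes. -/
  hom : x.base ⟶ y.base
  /-- The map of torsors. -/
  map : x.torsor.P ⟶ y.torsor.P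
  map_π : map ≫ y.torsor.π = x.torsor.π ≫ yoneda.map hom
  map_smul : ∀ {T : Scheme.{u}} (l : (Witt p T)ˣ) (a : x.torsor.P.obj (op T)),
    map.app (op T) (x.torsor.smul l a) = y.torsor.smul l (map.app (op T) a)
  map_ξ : ∀ {T : Scheme.{u}} (a : x.torsor.P.obj (op T)), y.ξ (map.app (op T) a) = x.ξ a

instance : Category (SigmaStack.{u} p) where
  Hom := SigmaStack.Hom
  id x :=
    { hom := 𝟙 _
      map := 𝟙 _
      map_π := by simp
      map_smul := by simp
      map_ξ := by simp }
  comp f g :=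
    { hom := f.hom ≫ g.hom
      map := f.map ≫ g.map
      map_π := by rw [Category.assoc, g.map_π, ← Category.assoc, f.map_π]; simp
      map_smul := by simp [f.map_smul, g.map_smul]
      map_ξ := by simp [f.map_ξ, g.map_ξ] }

/-- The structure functor of `Σ`, which sends an `S`-point of `Σ` to `S`. -/
def SigmaStack.toScheme : SigmaStack.{u} p ⥤ Scheme.{u} where
  obj x := x.base
  map f := f.hom

variable {p}

/-- The presheaf underlying the trivial `W^×`-torsor `W^× × S` over `S`. -/
def trivialTorsorPresheaf (S : Scheme.{u}) : Scheme.{u}ᵒᵖ ⥤ Type u where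
  obj T := (T.unop ⟶ S) × (Witt p T.unop)ˣ
  map f := TypeCat.ofHom fun a => (f.unop ≫ a.1, Witt.pullbackUnits f.unop a.2)
  map_id T := by
    ext a
    · simp
    · simp
  map_comp f g := by
    ext a
    · simp
    · simp [Witt.pullback_comp]

/-- The trivial torsor is functorial in the base. -/
def trivialTorsorPresheafMap {S S' : Scheme.{u}} (f : S ⟶ S') :
    trivialTorsorPresheaf (p := p) S ⟶ trivialTorsorPresheaf (p := p) S' where
  app T := TypeCat.ofHom fun a => (a.1 ≫ f, a.2)
  naturality T T' g := by
    ext a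
    exact Prod.ext (Category.assoc _ _ _) rfl

lemma witt_glue {T : Scheme.{u}} {R : Sieve T} (hR : R ∈ Scheme.fpqcTopology T)
    (w : ∀ ⦃U : Scheme.{u}⦄ (f : U ⟶ T), R f → Witt p U)
    (hw : ∀ ⦃U V : Scheme.{u}⦄ (f : U ⟶ T) (hf : R f) (g : V ⟶ U),
      Witt.pullback g (w f hf) = w (g ≫ f) (R.downward_closed hf g)) :
    ∃! v : Witt p T, ∀ ⦃U : Scheme.{u}⦄ (f : U ⟶ T) (hf : R f), Witt.pullback f v = w f hf := by
  let e := fun X : Scheme.{u} => AffineSpace.toSpecMvPolyIntEquiv (ULift.{u} ℕ) (X := X)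
  have hsheaf := GrothendieckTopology.Subcanonical.isSheaf_of_isRepresentable
    (J := Scheme.fpqcTopology.{u}) (yoneda.obj
      (Spec (CommRingCat.of (MvPolynomial (ULift.{u} ℕ) (ULift.{u} ℤ))))) R hR
  have hcomp : ∀ {U V : Scheme.{u}} (f : V ⟶ U) (v : Witt p U),
      f ≫ (e U).symm (fun i => v.coeff i.down) =
        (e V).symm (fun i => (Witt.pullback f v).coeff i.down) := by
    intro U V f v
    apply (e V).injective
    rw [Equiv.apply_symm_apply]
    ext i
    refine (AffineSpace.toSpecMvPolyIntEquiv_comp _ f _ i).trans ?_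
    rw [Equiv.apply_symm_apply]
    rfl
  have hinj : ∀ {U : Scheme.{u}} (v v' : Witt p U),
      (e U).symm (fun i => v.coeff i.down) = (e U).symm (fun i => v'.coeff i.down) → v = v' := by
    intro U v v' h
    ext n
    exact congrFun ((e U).symm.injective h) ⟨n⟩
  obtain ⟨t, ht, ht'⟩ := hsheaf
    (fun U f hf => (e U).symm fun i => (w f hf).coeff i.down) (by
      refine (Presieve.compatible_iff_sieveCompatible _).mpr ?_
      intro U V f g hf
      refine Eq.trans ?_ (hcomp g (w f hf)).symm
      simp only [hw])
  let v : Witt p T := WittVector.mk p fun n => e T t ⟨n⟩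
  have hv : (e T).symm (fun i => v.coeff i.down) = t := (e T).symm_apply_apply t
  refine ⟨v, fun U f hf => hinj _ _ ?_, fun v' hv' => hinj _ _ ?_⟩
  · rw [← hcomp, hv]
    exact ht f hf
  · rw [hv]
    refine ht' _ fun U f hf => ?_
    refine (hcomp f v').trans ?_
    rw [hv' f hf]

lemma trivialTorsorPresheaf_isSheaf (S : Scheme.{u}) :
    Presieve.IsSheaf Scheme.fpqcTopology (trivialTorsorPresheaf (p := p) S) := by
  intro T R hR x hx
  rw [Presieve.compatible_iff_sieveCompatible] at hx
  have hx1 : ∀ ⦃U V : Scheme.{u}⦄ (f : U ⟶ T) (g : V ⟶ U) (hf : R f),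
      (x (g ≫ f) (R.downward_closed hf g)).1 = g ≫ (x f hf).1 :=
    fun U V f g hf => congrArg Prod.fst (hx f g hf)
  have hx2 : ∀ ⦃U V : Scheme.{u}⦄ (f : U ⟶ T) (g : V ⟶ U) (hf : R f),
      (x (g ≫ f) (R.downward_closed hf g)).2 = Witt.pullbackUnits g (x f hf).2 :=
    fun U V f g hf => congrArg Prod.snd (hx f g hf)
  obtain ⟨b, hb, hb'⟩ := GrothendieckTopology.Subcanonical.isSheaf_of_isRepresentable
    (J := Scheme.fpqcTopology.{u}) (yoneda.obj S) R hR (fun U f hf => (x f hf).1) ((Presieve.compatible_iff_sieveCompatible _).mpr hx1)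
  obtain ⟨v, hv, hv'⟩ := witt_glue (p := p) hR (fun U f hf => ((x f hf).2 : Witt p U))
    fun U V f hf g => (congrArg Units.val (hx2 f g hf)).symm
  obtain ⟨v₁, hv₁, -⟩ := witt_glue (p := p) hR
    (fun U f hf => (((x f hf).2⁻¹ : (Witt p U)ˣ) : Witt p U))
    fun U V f hf g => by
      rw [hx2 f g hf, ← map_inv]
      rfl
  obtain ⟨o, -, ho⟩ := witt_glue (p := p) hR (fun U _ _ => (1 : Witt p U))
    fun U V f hf g => map_one _
  have h1 : v * v₁ = 1 := by
    rw [ho (v * v₁) fun U f hf => by rw [map_mul, hv f hf, hv₁ f hf, Units.mul_inv],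
      ho 1 fun U f hf => map_one _]
  let l : (Witt p T)ˣ := ⟨v, v₁, h1, by rw [mul_comm, h1]⟩
  refine ⟨(b, l), fun U f hf => Prod.ext (hb f hf) (Units.ext (hv f hf)), fun y hy => ?_⟩
  refine Prod.ext (hb' y.1 fun U f hf => congrArg Prod.fst (hy f hf)) (Units.ext ?_)
  exact hv' _ fun U f hf => congrArg (fun z => (z.2 : Witt p U)) (hy f hf)

/-- The trivial `W^×`-torsor `W^× × S` over `S`. -/
def trivialTorsor (S : Scheme.{u}) : WittTorsor.{u} p S where
  P := trivialTorsorPresheaf S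
  isSheaf := trivialTorsorPresheaf_isSheaf S
  π := { app := fun T => TypeCat.ofHom fun a => a.1 }
  smul l a := (a.1, l * a.2)
  one_smul a := Prod.ext rfl (one_mul a.2)
  mul_smul l m a := Prod.ext rfl (mul_assoc l m a.2)
  map_smul f l a := Prod.ext rfl (map_mul (Witt.pullbackUnits f) l a.2)
  π_smul l a := rfl
  simply_transitive a b h := by
    refine ⟨b.2 * a.2⁻¹, Prod.ext h (by simp), fun l hl => ?_⟩
    rw [← hl]; simp
  locally_nonempty := ⟨⊤, GrothendieckTopology.top_mem _ _, fun T f _ => ⟨(f, 1), rfl⟩⟩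

variable (p)

/-- The quotient morphism `W_prim ⟶ Σ = W_prim / W^×`: it sends a point `x` of `W_prim` to the trivial
torsor equipped with the map `λ ↦ λ x`. -/
def quotientMap : WPrim.{u} p ⥤ SigmaStack.{u} p where
  obj x :=
    { base := x.base
      isPNilpotent := x.isPrimitive.isPNilpotent
      torsor := trivialTorsor x.base
      ξ := fun a => (a.2 : Witt p _) * Witt.pullback a.1 x.val
      ξ_isPrimitive := fun a => (x.isPrimitive.pullback a.1).units_mul a.2
      ξ_map := fun f a => by
        rw [map_mul, ← Witt.pullback_comp]; rfl
      ξ_smul := fun {T} l a => by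
        change ((l * a.2 : (Witt p T)ˣ) : Witt p T) * Witt.pullback a.1 x.val =
          (l : Witt p T) * ((a.2 : Witt p T) * Witt.pullback a.1 x.val)
        rw [Units.val_mul, mul_assoc] }
  map {x y} f :=
    { hom := f.hom
      map := trivialTorsorPresheafMap f.hom
      map_π := rfl
      map_smul := fun l a => rfl
      map_ξ := fun {T} a => by
        change (a.2 : Witt p T) * Witt.pullback (a.1 ≫ f.hom) y.val =
          (a.2 : Witt p T) * Witt.pullback a.1 x.val
        rw [Witt.pullback_comp, f.pullback_val] }

/-- The morphism `p : Spf ℤ_p ⟶ Σ`, the composition of `p : Spf ℤ_p ⟶ W_prim` and the quotient morphism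
`W_prim ⟶ Σ`. -/
def sigmaPointP : SpfZp.{u} p ⥤ SigmaStack.{u} p :=
  pointP p ⋙ quotientMap p

/-- The canonical homomorphism `ℤ_p → H⁰(Σ, 𝒪_Σ)`. -/
def padicIntToSigma : ℤ_[p] →+* globalFunctions (SigmaStack.toScheme.{u} p) :=
  padicIntToGlobalFunctions (SigmaStack.toScheme.{u} p) p fun x => x.isPNilpotent

end Witt

end Prismatization

end

/-! A primitive Witt vector `w` and its unit multiples define isomorphic points of Σ, so a closed
substack through which `p` factors contains all unit multiples of `p`. For part (1), fpqc descent
reduces everything to showing that functions vanishing at these multiples vanish at every primitive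
`w` over an affine scheme, where `p ^ m = 0` and `w₀ ^ m = 0` for some `m`.

The multiples used are `p u + [p² X]` with `u₀` invertible and `X` a free variable. Since `[p²] = p
μ` with `μ₀ = p`, such a vector is `p ν` with `ν₀ = u₀ + p X`, and `ν` is a unit when `p` is
nilpotent. The core is `mem_span_of_pow_dvd_wittEval_genericMultiple`: a polynomial `g` in the Witt
coordinates whose value at `p u + [p² X]` is divisible by `p ^ (6m)` lies in the ideal generated by
`p ^ m` and the `m`-th power of the zeroth coordinate, hence vanishes at `w`. To see this, let `G`
be the value of `g` at `p u + [X - p u₀]`, whose zeroth component is `X`. The value at `p u + [p²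
X]` is `G(p u₀ + p² X)`, and its divisibility forces `p ^ m` to divide the first `m` coefficients of
`G`. Modulo `p` the vector `p u + [X - p u₀]` is `(X, u₀ᵖ, u₁ᵖ, …)`, so passing from `g` to `G` is
the injective substitution `xₙ ↦ xₙᵖ` in the coefficients; divisibility therefore descends from `G`
to `g`, one power of `p` at a time.

For part (2), the zero locus of a global function is a closed substack, so by (1) a function on Σ is
determined by its restriction along `p` to `Spf ℤ_p`. Evaluation on `Spec ℤ/pⁿ` identifies functions
on `Spf ℤ_p` with the limit of the rings `ℤ/pⁿ`, which is `ℤ_p`. -/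

namespace Prismatization

/-! ### Witt vectors of the form `p u + [c]` -/

section WittAlgebra

variable {p : ℕ} [Fact p.Prime] {R : Type u} [CommRing R]

lemma exists_eq_verschiebung {x : WittVector p R} (hx : x.coeff 0 = 0) :
    ∃ y, x = WittVector.verschiebung y :=
  ⟨x.shift 1, WittVector.eq_iterate_verschiebung (n := 1) (by simpa using hx)⟩

/-- The Teichmüller representative of `p²` is divisible by `p`, with quotient congruent to `p`. -/
lemma exists_teichmuller_p_sq (p : ℕ) [Fact p.Prime] (R : Type u) [CommRing R] :
    ∃ μ : WittVector p R, WittVector.teichmuller p ((p : R) ^ 2) = p * μ ∧ μ.coeff 0 = p := by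
  -- `[p]` and `p` have the same zeroth component, so `[p] = p + V y`. In general `[p]` is not
  -- divisible by `p`, but its square is, because `(V y)² = p V(y²)`.
  obtain ⟨y, hy⟩ := exists_eq_verschiebung
    (x := WittVector.teichmuller p (p : R) - (p : WittVector p R)) (by
      have := map_sub (WittVector.constantCoeff (p := p) (R := R))
        (WittVector.teichmuller p (p : R)) (p : WittVector p R)
      simpa [WittVector.teichmuller_coeff_zero] using this)
  have hyy : WittVector.verschiebung y * WittVector.verschiebung y =
      p * WittVector.verschiebung (y * y) := by
    rw [← WittVector.verschiebung_mul_frobenius, WittVector.frobenius_verschiebung, ← mul_assoc,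
      mul_comm (p : WittVector p R)]
    have h := WittVector.verschiebung_mul_frobenius (y * y) (p : WittVector p R)
    rw [map_natCast] at h
    exact h
  refine ⟨p + 2 * WittVector.verschiebung y + WittVector.verschiebung (y * y), ?_, ?_⟩
  · rw [map_pow, eq_add_of_sub_eq hy]
    linear_combination hyy
  · rw [WittVector.add_coeff_zero, WittVector.add_coeff_zero, WittVector.mul_coeff_zero,
      WittVector.verschiebung_coeff_zero, WittVector.verschiebung_coeff_zero, witt_p_coeff_zero]
    ring

lemma natCast_mul_coeff_zero (u : WittVector p R) :
    ((p : WittVector p R) * u).coeff 0 = p * u.coeff 0 := by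
  rw [WittVector.mul_coeff_zero, witt_p_coeff_zero]

lemma coeff_zero_natCast_mul_add_teichmuller (u : WittVector p R) (c : R) :
    ((p : WittVector p R) * u + WittVector.teichmuller p c).coeff 0 = p * u.coeff 0 + c := by
  rw [WittVector.add_coeff_zero, natCast_mul_coeff_zero, WittVector.teichmuller_coeff_zero]

/-- In characteristic `p`, the components of `p u + [c]` are `c, u₀ᵖ, u₁ᵖ, …`. -/
lemma coeff_succ_natCast_mul_add_teichmuller [CharP R p] (u : WittVector p R) (c : R) (n : ℕ) :
    ((p : WittVector p R) * u + WittVector.teichmuller p c).coeff (n + 1) = u.coeff n ^ p := by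
  rw [mul_comm, ← WittVector.verschiebung_frobenius, WittVector.coeff_add_of_disjoint]
  · rw [WittVector.verschiebung_coeff_succ, WittVector.coeff_frobenius_charP,
      WittVector.teichmuller_coeff_pos _ _ _ n.succ_pos, add_zero]
  · rintro (_ | n)
    · exact Or.inl (WittVector.verschiebung_coeff_zero _)
    · exact Or.inr (WittVector.teichmuller_coeff_pos _ _ _ n.succ_pos)

end WittAlgebra

/-! ### The universal Witt vector -/

section UniversalWitt

open Polynomial

/-- The polynomial ring in `X` over `ℤ[x₀, x₁, …]`. -/
abbrev WittPoly := (MvPolynomial ℕ ℤ)[X]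

/-- The ring homomorphism out of `WittPoly` corresponding to a Witt vector: it sends `X` to the
component of index `0` and `xₙ` to the component of index `n + 1`. -/
noncomputable def wittEval {p : ℕ} {R : Type*} [CommRing R] (w : WittVector p R) : WittPoly →+* R :=
  eval₂RingHom (MvPolynomial.eval₂Hom (Int.castRingHom R) fun n => w.coeff (n + 1)) (w.coeff 0)

variable {p : ℕ} {R S : Type*} [CommRing R] [CommRing S]

@[simp]
lemma wittEval_X (w : WittVector p R) : wittEval w X = w.coeff 0 := by
  simp [wittEval]

@[simp]
lemma wittEval_C_X (w : WittVector p R) (n : ℕ) :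
    wittEval w (C (MvPolynomial.X n)) = w.coeff (n + 1) := by
  simp [wittEval]

lemma wittPoly_hom_ext {f g : WittPoly →+* R} (h0 : f X = g X)
    (h : ∀ n, f (C (MvPolynomial.X n)) = g (C (MvPolynomial.X n))) : f = g := by
  refine Polynomial.ringHom_ext (fun a => ?_) h0
  have : f.comp C = g.comp C := MvPolynomial.ringHom_ext (fun r => by simp) h
  exact congrArg (fun k => k a) this

lemma comp_wittEval [Fact p.Prime] (f : R →+* S) (w : WittVector p R) :
    f.comp (wittEval w) = wittEval (WittVector.map f w) :=
  wittPoly_hom_ext (by simp) (by simp)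

variable (p) in
/-- The Witt vector over `WittPoly` with components `x₀, x₁, …`. -/
noncomputable def genericUnit : WittVector p WittPoly := WittVector.mk p fun n => C (MvPolynomial.X n)

lemma genericUnit_coeff (n : ℕ) : (genericUnit p).coeff n = C (MvPolynomial.X n) := rfl

variable [Fact p.Prime]

variable (p) in
/-- The Witt vector `p u + [X - p u₀]`, whose component of index `0` is `X`. -/
noncomputable def genericVector : WittVector p WittPoly :=
  (p : WittVector p WittPoly) * genericUnit p + WittVector.teichmuller p (X - (p : WittPoly) * C (MvPolynomial.X 0))

variable (p) in
/-- The Witt vector `p u + [p² X]`. -/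
noncomputable def genericMultiple : WittVector p WittPoly :=
  (p : WittVector p WittPoly) * genericUnit p + WittVector.teichmuller p ((p : WittPoly) ^ 2 * X)

lemma genericVector_coeff_zero : (genericVector p).coeff 0 = X := by
  rw [genericVector, coeff_zero_natCast_mul_add_teichmuller, genericUnit_coeff]
  ring

lemma genericMultiple_coeff_zero :
    (genericMultiple p).coeff 0 = (p : WittPoly) * (C (MvPolynomial.X 0) + (p : WittPoly) * X) := by
  rw [genericMultiple, coeff_zero_natCast_mul_add_teichmuller, genericUnit_coeff]
  ring

lemma exists_genericMultiple_eq :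
    ∃ ν : WittVector p WittPoly, genericMultiple p = p * ν ∧
      ν.coeff 0 = C (MvPolynomial.X 0) + (p : WittPoly) * X := by
  obtain ⟨μ, hμ, hμ0⟩ := exists_teichmuller_p_sq p WittPoly
  refine ⟨genericUnit p + μ * WittVector.teichmuller p X, ?_, ?_⟩
  · rw [genericMultiple, map_mul, hμ]
    ring
  · rw [WittVector.add_coeff_zero, WittVector.mul_coeff_zero, hμ0, genericUnit_coeff,
      WittVector.teichmuller_coeff_zero]

/-- The substitution `X ↦ p² X + p x₀` turns `X - p x₀` into `p² X`, hence `genericVector` into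
`genericMultiple`. It is split into a translation and a dilation so that coefficients can be
followed through each. -/
lemma wittEval_genericMultiple (g : WittPoly) :
    wittEval (genericMultiple p) g =
      (taylor ((p : MvPolynomial ℕ ℤ) * MvPolynomial.X 0) (wittEval (genericVector p) g)).comp
        (C ((p : MvPolynomial ℕ ℤ) ^ 2) * X) := by
  let σ : WittPoly →+* WittPoly :=
    (compRingHom (C ((p : MvPolynomial ℕ ℤ) ^ 2) * X)).comp
      (compRingHom (X + C ((p : MvPolynomial ℕ ℤ) * MvPolynomial.X 0)))
  have hσ : WittVector.map σ (genericVector p) = genericMultiple p := by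
    rw [genericVector, genericMultiple, map_add, map_mul, map_natCast, WittVector.map_teichmuller]
    congr 2
    · ext n : 1
      simp [genericUnit_coeff, σ]
    · simp [σ]
  rw [← hσ, ← comp_wittEval]
  rfl

/-- Reduction modulo `p` turns `genericVector` into `(X, x₀ᵖ, x₁ᵖ, …)`. -/
lemma map_coeff_wittEval_genericVector (g : WittPoly) (j : ℕ) :
    MvPolynomial.map (Int.castRingHom (ZMod p)) ((wittEval (genericVector p) g).coeff j) =
      MvPolynomial.expand p (MvPolynomial.map (Int.castRingHom (ZMod p)) (g.coeff j)) := by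
  let ρ : WittPoly →+* (MvPolynomial ℕ (ZMod p))[X] :=
    mapRingHom (MvPolynomial.map (Int.castRingHom (ZMod p)))
  have key : ρ.comp (wittEval (genericVector p)) =
      (mapRingHom (MvPolynomial.expand p : MvPolynomial ℕ (ZMod p) →ₐ[ZMod p] _).toRingHom).comp ρ := by
    have : CharP (MvPolynomial ℕ (ZMod p)) p := inferInstance
    have : CharP ((MvPolynomial ℕ (ZMod p))[X]) p := inferInstance
    rw [comp_wittEval]
    refine wittPoly_hom_ext ?_ fun n => ?_
    · simp [genericVector_coeff_zero, ρ]
    · rw [wittEval_C_X, genericVector, map_add, map_mul, map_natCast, WittVector.map_teichmuller,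
        coeff_succ_natCast_mul_add_teichmuller, WittVector.map_coeff, genericUnit_coeff]
      simp [ρ]
  have := congrArg (fun h => (h g).coeff j) key
  simpa [ρ] using this

/-- `MvPolynomial.expand p` is injective over `ZMod p`. -/
lemma p_dvd_coeff_wittEval_genericVector {g : WittPoly} {j : ℕ}
    (h : (p : MvPolynomial ℕ ℤ) ∣ (wittEval (genericVector p) g).coeff j) :
    (p : MvPolynomial ℕ ℤ) ∣ g.coeff j := by
  have hC : (p : MvPolynomial ℕ ℤ) = MvPolynomial.C (p : ℤ) := by simp
  rw [hC, MvPolynomial.C_dvd_iff_zmod] at h ⊢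
  rw [map_coeff_wittEval_genericVector] at h
  exact (MvPolynomial.expand_eq_zero (Fact.out : p.Prime).pos).mp h

lemma natCast_p_ne_zero : (p : MvPolynomial ℕ ℤ) ≠ 0 := by
  exact_mod_cast (Fact.out : p.Prime).ne_zero

/-- Induction on `a`: write `g` as `p ^ a * f` modulo `X ^ m`, cancel `p ^ a` after evaluation, and
apply the mod `p` statement to `f`. -/
lemma pow_dvd_coeff_of_wittEval_genericVector {g : WittPoly} {m : ℕ}
    (h : ∀ j < m, (p : MvPolynomial ℕ ℤ) ^ m ∣ (wittEval (genericVector p) g).coeff j)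
    {a : ℕ} (ha : a ≤ m) : ∀ j < m, (p : MvPolynomial ℕ ℤ) ^ a ∣ g.coeff j := by
  induction a with
  | zero => simp
  | succ a ih =>
    have ih := ih (by omega)
    choose! k hk using ih
    let f : WittPoly := ∑ j ∈ Finset.range m, monomial j (k j)
    have hf : ∀ j < m, f.coeff j = k j := fun j hj => by
      simp [f, coeff_monomial, hj]
    have hX : X ^ m ∣ g - C ((p : MvPolynomial ℕ ℤ) ^ a) * f := by
      rw [X_pow_dvd_iff]
      intro j hj
      rw [coeff_sub, coeff_C_mul, hf j hj, hk j hj, sub_self]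
    obtain ⟨r, hr⟩ := hX
    have hr' := congrArg (wittEval (genericVector p)) hr
    -- Evaluation at `genericVector` fixes `X`, so the multiple of `X ^ m` stays one and does not
    -- touch the coefficients below `m`.
    rw [map_sub, map_mul, map_mul, map_pow _ X, wittEval_X, genericVector_coeff_zero] at hr'
    intro j hj
    have hj' := congrArg (fun q => coeff q j) hr'
    have hC : wittEval (genericVector p) (C ((p : MvPolynomial ℕ ℤ) ^ a)) =
        C ((p : MvPolynomial ℕ ℤ) ^ a) := by simp
    simp only [hC, coeff_sub, coeff_C_mul, coeff_X_pow_mul', not_le.mpr hj, if_false] at hj'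
    have h1 : (p : MvPolynomial ℕ ℤ) ^ a * p ∣
        (p : MvPolynomial ℕ ℤ) ^ a * (wittEval (genericVector p) f).coeff j := by
      rw [← sub_eq_zero.mp hj', ← pow_succ]
      exact (pow_dvd_pow _ ha).trans (h j hj)
    have h2 := p_dvd_coeff_wittEval_genericVector
      ((mul_dvd_mul_iff_left (pow_ne_zero _ natCast_p_ne_zero)).mp h1)
    rw [hf j hj] at h2
    rw [hk j hj, pow_succ]
    exact mul_dvd_mul_left _ h2

/-- Let `G'` be the translate of `G`, so that `G = ∑ G'ₖ (X - p b)ᵏ`. The hypothesis says that `p ^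
(6m)` divides `p ^ (2k) G'ₖ`. For `k < 2m` this leaves more than `p ^ (2m)` in `G'ₖ`; for `k ≥ 2m`
and `j < m` the coefficient of `X ^ j` in `(X - p b)ᵏ` already contains `p ^ (k - j)` with `k - j ≥
m`. -/
lemma pow_dvd_coeff_of_taylor_comp {G : WittPoly} {m : ℕ} {b : MvPolynomial ℕ ℤ}
    (h : (p : WittPoly) ^ (6 * m) ∣
      (taylor ((p : MvPolynomial ℕ ℤ) * b) G).comp (C ((p : MvPolynomial ℕ ℤ) ^ 2) * X)) :
    ∀ j < m, (p : MvPolynomial ℕ ℤ) ^ m ∣ G.coeff j := by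
  intro j hj
  set G' := taylor ((p : MvPolynomial ℕ ℤ) * b) G with hG'
  have hG : G = taylor (-((p : MvPolynomial ℕ ℤ) * b)) G' := by
    rw [hG', taylor_taylor]
    simp
  have hC : (p : WittPoly) ^ (6 * m) = C ((p : MvPolynomial ℕ ℤ) ^ (6 * m)) := by simp
  rw [hC, C_dvd_iff_dvd_coeff] at h
  rw [hG, taylor_apply, comp_eq_sum_left, Polynomial.sum, finsetSum_coeff]
  refine Finset.dvd_sum fun k _ => ?_
  rw [coeff_C_mul, coeff_X_add_C_pow]
  by_cases hk : k < 2 * m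
  · refine Dvd.dvd.mul_right ?_ _
    have hk' := h k
    rw [comp_C_mul_X_coeff, ← pow_mul, mul_comm (G'.coeff k),
      show 6 * m = 2 * k + (6 * m - 2 * k) by omega, pow_add,
      mul_dvd_mul_iff_left (pow_ne_zero _ natCast_p_ne_zero)] at hk'
    exact (pow_dvd_pow _ (by omega)).trans hk'
  · refine Dvd.dvd.mul_left (Dvd.dvd.mul_right ?_ _) _
    rw [neg_pow, mul_pow]
    exact Dvd.dvd.mul_left (Dvd.dvd.mul_right (pow_dvd_pow _ (by omega)) _) _

/-- A function on the space of Witt vectors which vanishes modulo a high power of `p` at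
the vectors `p u + [p² X]` belongs to the ideal `(pᵐ, Xᵐ)`. -/
theorem mem_span_of_pow_dvd_wittEval_genericMultiple {g : WittPoly} {m : ℕ}
    (h : (p : WittPoly) ^ (6 * m) ∣ wittEval (genericMultiple p) g) :
    g ∈ Ideal.span {(p : WittPoly) ^ m, X ^ m} := by
  rw [wittEval_genericMultiple] at h
  have h' := pow_dvd_coeff_of_wittEval_genericVector (pow_dvd_coeff_of_taylor_comp h) le_rfl
  choose! k hk using h'
  rw [Ideal.mem_span_pair]
  have hX : X ^ m ∣ g - C ((p : MvPolynomial ℕ ℤ) ^ m) * ∑ j ∈ Finset.range m, monomial j (k j) := by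
    rw [X_pow_dvd_iff]
    intro j hj
    rw [coeff_sub, coeff_C_mul]
    simp [coeff_monomial, hj, hk j hj]
  obtain ⟨r, hr⟩ := hX
  refine ⟨∑ j ∈ Finset.range m, monomial j (k j), r, ?_⟩
  rw [map_pow, map_natCast] at hr
  linear_combination -hr

/-- `p` is prime in `WittPoly` and does not divide `x₀`; this undoes the localization at `x₀`. -/
lemma pow_dvd_of_pow_dvd_C_X_mul {q : WittPoly} {N r : ℕ}
    (h : (p : WittPoly) ^ N ∣ C (MvPolynomial.X 0) ^ r * q) : (p : WittPoly) ^ N ∣ q := by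
  have hp : Prime (p : WittPoly) := by
    have : (p : WittPoly) = C (MvPolynomial.C (p : ℤ)) := by simp
    rw [this, prime_C_iff, MvPolynomial.prime_C_iff]
    exact Nat.prime_iff_prime_int.mp Fact.out
  refine hp.pow_dvd_of_dvd_mul_left N (fun hd => ?_) h
  have hd := hp.dvd_of_dvd_pow hd
  have : (p : WittPoly) = C (MvPolynomial.C (p : ℤ)) := by simp
  rw [this, C_dvd_iff_dvd_coeff] at hd
  have hd := hd 0
  rw [coeff_C_zero, MvPolynomial.C_dvd_iff_dvd_coeff] at hd
  have hd := hd (Finsupp.single 0 1)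
  simp only [MvPolynomial.coeff_X, if_true] at hd
  exact (Nat.prime_iff_prime_int.mp (Fact.out : p.Prime)).not_isUnit (isUnit_of_dvd_one (by simpa using hd))

end UniversalWitt

/-! ### Units in rings of Witt vectors -/

section WittUnits

variable {p : ℕ} [Fact p.Prime] {R : Type u} [CommRing R]

lemma iterate_verschiebung_coeff_of_lt (x : WittVector p R) {n i : ℕ} (h : i < n) :
    (WittVector.verschiebung^[n] x).coeff i = 0 := by
  induction n generalizing i with
  | zero => omega
  | succ n ih =>
    rw [Function.iterate_succ_apply']
    cases i with
    | zero => exact WittVector.verschiebung_coeff_zero _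
    | succ i => exact ih (by omega)

lemma add_iterate_verschiebung_coeff_of_lt (x y : WittVector p R) {n i : ℕ} (h : i < n) :
    (x + WittVector.verschiebung^[n] y).coeff i = x.coeff i := by
  have hy : WittVector.verschiebung^[n] y ∈ RingHom.ker (WittVector.truncate (p := p) n) :=
    (WittVector.mem_ker_truncate n _).mpr fun j hj => iterate_verschiebung_coeff_of_lt y hj
  have := congrArg (fun t => t.coeff ⟨i, h⟩)
    (map_add (WittVector.truncate (p := p) n) x (WittVector.verschiebung^[n] y))
  rw [RingHom.mem_ker.mp hy, add_zero] at this
  simpa only [WittVector.coeff_truncate] using this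

lemma mul_iterate_verschiebung (x y : WittVector p R) (n : ℕ) :
    x * WittVector.verschiebung^[n] y =
      WittVector.verschiebung^[n] (WittVector.frobenius^[n] x * y) := by
  induction n generalizing x with
  | zero => rfl
  | succ n ih =>
    rw [Function.iterate_succ_apply', mul_comm, ← WittVector.verschiebung_mul_frobenius, mul_comm,
      ih, Function.iterate_succ_apply', Function.iterate_succ_apply]

/-- The zeroth component of `F x` is the ghost component `x₀ᵖ + p x₁`, a unit plus a nilpotent. -/
lemma isUnit_frobenius_coeff_zero (hp : IsNilpotent (p : R)) {x : WittVector p R}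
    (hx : IsUnit (x.coeff 0)) : IsUnit ((WittVector.frobenius x).coeff 0) := by
  have h := WittVector.ghostComponent_frobenius 0 x
  simp only [WittVector.ghostComponent_apply, aeval_wittPolynomial, Finset.sum_range_succ,
    Finset.sum_range_zero] at h
  simp only [pow_zero, pow_one, one_mul, zero_add, Nat.sub_zero, Nat.sub_self] at h
  rw [h]
  exact (Commute.isNilpotent_mul_right (Commute.all _ _) hp).isUnit_add_left_of_commute
    (hx.pow p) (Commute.all _ _)

/-- Over a ring in which `p` is nilpotent, a Witt vector is a unit if its component of index `0`
is a unit. -/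
theorem isUnit_of_isUnit_coeff_zero (hp : IsNilpotent (p : R)) {x : WittVector p R}
    (hx : IsUnit (x.coeff 0)) : IsUnit x := by
  have hF : ∀ n, IsUnit ((WittVector.frobenius^[n] x).coeff 0) := fun n => by
    induction n with
    | zero => exact hx
    | succ n ih =>
      rw [Function.iterate_succ_apply']
      exact isUnit_frobenius_coeff_zero hp ih
  -- Successive approximation of the inverse. If `1 - x y = Vⁿ r`, adding `Vⁿ[c r₀]` to `y`, with
  -- `c` inverse to the zeroth component of `Fⁿ x`, moves the error into `Vⁿ⁺¹`, by the projection
  -- formula `x Vⁿ z = Vⁿ(Fⁿ x · z)`.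
  have step : ∀ (n : ℕ) (y : WittVector p R), (∀ i < n, (1 - x * y).coeff i = 0) →
      ∃ y' : WittVector p R, (∀ i < n + 1, (1 - x * y').coeff i = 0) ∧
        ∀ i < n, y'.coeff i = y.coeff i := by
    intro n y hy
    obtain ⟨c, hc⟩ := (hF n).exists_right_inv
    set r := (1 - x * y).shift n
    have hr : 1 - x * y = WittVector.verschiebung^[n] r := WittVector.eq_iterate_verschiebung hy
    refine ⟨y + WittVector.verschiebung^[n] (WittVector.teichmuller p (c * r.coeff 0)), ?_,
      fun i hi => add_iterate_verschiebung_coeff_of_lt _ _ hi⟩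
    have h1 : 1 - x * (y + WittVector.verschiebung^[n] (WittVector.teichmuller p (c * r.coeff 0))) =
        WittVector.verschiebung^[n]
          (r - WittVector.frobenius^[n] x * WittVector.teichmuller p (c * r.coeff 0)) := by
      rw [iterate_map_sub, ← hr, ← mul_iterate_verschiebung]
      ring
    obtain ⟨z, hz⟩ := exists_eq_verschiebung
      (x := r - WittVector.frobenius^[n] x * WittVector.teichmuller p (c * r.coeff 0)) (by
        have := map_sub (WittVector.constantCoeff (p := p) (R := R)) r
          (WittVector.frobenius^[n] x * WittVector.teichmuller p (c * r.coeff 0))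
        refine this.trans ?_
        rw [map_mul]
        change r.coeff 0 - (WittVector.frobenius^[n] x).coeff 0 *
          (WittVector.teichmuller p (c * r.coeff 0)).coeff 0 = 0
        rw [WittVector.teichmuller_coeff_zero, ← mul_assoc, hc, one_mul, sub_self])
    rw [h1, hz, ← Function.iterate_succ_apply]
    exact fun i hi => iterate_verschiebung_coeff_of_lt _ hi
  choose! f hf hf' using step
  let Y : ℕ → WittVector p R := fun n => Nat.rec 0 f n
  have hY : ∀ n, ∀ i < n, (1 - x * Y n).coeff i = 0 := fun n => by
    induction n with
    | zero => simp
    | succ n ih => exact hf n (Y n) ih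
  have hYm : ∀ n m i, i < n → n ≤ m → (Y m).coeff i = (Y n).coeff i := fun n m i hi hm => by
    induction m, hm using Nat.le_induction with
    | base => rfl
    | succ m hm ih => exact (hf' m (Y m) (hY m) i (by omega)).trans ih
  -- The component of index `i` no longer changes from the approximation `Y (i + 1)` on.
  let y : WittVector p R := WittVector.mk p fun i => (Y (i + 1)).coeff i
  refine IsUnit.of_mul_eq_one y ?_
  ext i
  have h1 : WittVector.truncate (p := p) (i + 1) y = WittVector.truncate (i + 1) (Y (i + 1)) := by
    ext j
    rw [WittVector.coeff_truncate, WittVector.coeff_truncate]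
    exact (hYm (j + 1) (i + 1) j (by omega) (by omega)).symm
  have h2 : WittVector.truncate (p := p) (i + 1) (1 - x * Y (i + 1)) = 0 :=
    RingHom.mem_ker.mp ((WittVector.mem_ker_truncate _ _).mpr (hY (i + 1)))
  have h3 : WittVector.truncate (p := p) (i + 1) (x * y) = WittVector.truncate (i + 1) 1 := by
    rw [map_mul, h1, ← map_mul]
    rw [map_sub, sub_eq_zero] at h2
    exact h2.symm
  have := congrArg (fun t => t.coeff ⟨i, i.lt_succ_self⟩) h3
  simpa only [WittVector.coeff_truncate] using this

end WittUnits

/-! ### Localized quotients of the universal ring -/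

section LocalizedQuotient

variable {A : Type*} [CommRing A] (J : Ideal A) (a : A)

/-- The localization of `A ⧸ J` at `a`, in a given universe. -/
abbrev LocalizedQuotient : Type max u _ :=
  ULift.{u} (Localization.Away (Ideal.Quotient.mk J a))

/-- The canonical homomorphism to the localization of `A ⧸ J` at `a`. -/
noncomputable def toLocalizedQuotient : A →+* LocalizedQuotient.{u} J a :=
  (ULift.ringEquiv.symm.toRingHom.comp (algebraMap (A ⧸ J) (Localization.Away
    (Ideal.Quotient.mk J a)))).comp (Ideal.Quotient.mk J)

variable {J a}

lemma toLocalizedQuotient_eq_zero {q : A} (hq : q ∈ J) : toLocalizedQuotient.{u} J a q = 0 := by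
  rw [toLocalizedQuotient, RingHom.comp_apply, Ideal.Quotient.eq_zero_iff_mem.mpr hq, map_zero]

lemma isUnit_toLocalizedQuotient : IsUnit (toLocalizedQuotient.{u} J a a) :=
  (IsLocalization.Away.algebraMap_isUnit (S := Localization.Away (Ideal.Quotient.mk J a))
    (Ideal.Quotient.mk J a)).map (ULift.ringEquiv (R := Localization.Away
      (Ideal.Quotient.mk J a))).symm.toRingHom

lemma exists_mem_of_toLocalizedQuotient_eq_zero {q : A}
    (hq : toLocalizedQuotient.{u} J a q = 0) : ∃ r, a ^ r * q ∈ J := by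
  have h : algebraMap (A ⧸ J) (Localization.Away (Ideal.Quotient.mk J a))
      (Ideal.Quotient.mk J q) = 0 :=
    ULift.ringEquiv.symm.injective (hq.trans (map_zero ULift.ringEquiv.symm).symm)
  rw [IsLocalization.map_eq_zero_iff (Submonoid.powers (Ideal.Quotient.mk J a))] at h
  obtain ⟨⟨_, r, rfl⟩, h⟩ := h
  refine ⟨r, Ideal.Quotient.eq_zero_iff_mem.mp ?_⟩
  rw [map_mul, map_pow]
  exact h

lemma exists_mul_eq_toLocalizedQuotient (f : LocalizedQuotient.{u} J a) :
    ∃ (q : A) (r : ℕ), f * toLocalizedQuotient.{u} J a a ^ r = toLocalizedQuotient.{u} J a q := by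
  obtain ⟨⟨b, ⟨_, r, rfl⟩⟩, ha⟩ := IsLocalization.surj (Submonoid.powers
    (Ideal.Quotient.mk J a)) (ULift.ringEquiv f)
  obtain ⟨q, rfl⟩ := Ideal.Quotient.mk_surjective b
  refine ⟨q, r, ULift.ringEquiv.injective ?_⟩
  rw [map_mul, map_pow]
  simp only [map_pow] at ha
  exact ha

lemma exists_localizedQuotient_lift {R : Type*} [CommRing R] (g : A →+* R)
    (hg : ∀ q ∈ J, g q = 0) (ha : IsUnit (g a)) :
    ∃ l : LocalizedQuotient.{u} J a →+* R, l.comp (toLocalizedQuotient J a) = g := by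
  have hu : IsUnit (Ideal.Quotient.lift J g hg (Ideal.Quotient.mk J a)) := by
    rwa [Ideal.Quotient.lift_mk]
  refine ⟨(IsLocalization.Away.lift (S := Localization.Away (Ideal.Quotient.mk J a))
    (g := Ideal.Quotient.lift J g hg) _ hu).comp ULift.ringEquiv.toRingHom, ?_⟩
  ext1 q
  exact (IsLocalization.Away.lift_eq _ hu _).trans (Ideal.Quotient.lift_mk _ _ _)

open Polynomial

variable {p : ℕ} [Fact p.Prime]

/-- A function on a localized quotient of the universal ring that vanishes modulo `p^(6m)` at the
Witt vectors `p u + [p² X]` vanishes at all Witt vectors `w` with `pᵐ = 0`, `w₀ᵐ = 0` and `w₁`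
invertible. -/
theorem eq_zero_of_localizedQuotient {R : Type*} [CommRing R] {J : Ideal WittPoly} {m : ℕ}
    {w : WittVector p R}
    (l : LocalizedQuotient.{u} J (C (MvPolynomial.X 0)) →+* R)
    (hl : l.comp (toLocalizedQuotient J _) = wittEval w)
    (hp : (p : R) ^ m = 0) (h0 : w.coeff 0 ^ m = 0) (h1 : IsUnit (w.coeff 1))
    (t : LocalizedQuotient.{u} J (C (MvPolynomial.X 0)) →+*
      LocalizedQuotient.{u} (Ideal.span {(p : WittPoly) ^ (6 * m)}) (C (MvPolynomial.X 0)))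
    (ht : t.comp (toLocalizedQuotient J _) =
      (toLocalizedQuotient _ _).comp (wittEval (genericMultiple p)))
    {f : LocalizedQuotient.{u} J (C (MvPolynomial.X 0))} (hf : t f = 0) : l f = 0 := by
  obtain ⟨q, r, hq⟩ := exists_mul_eq_toLocalizedQuotient f
  have hq0 : toLocalizedQuotient.{u} (Ideal.span {(p : WittPoly) ^ (6 * m)})
      (C (MvPolynomial.X 0)) (wittEval (genericMultiple p) q) = 0 := by
    have := congrArg (fun k => k q) ht
    refine this.symm.trans ?_
    rw [RingHom.comp_apply, ← hq, map_mul, hf, zero_mul]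
  obtain ⟨s, hs⟩ := exists_mem_of_toLocalizedQuotient_eq_zero hq0
  have hmem := mem_span_of_pow_dvd_wittEval_genericMultiple
    (pow_dvd_of_pow_dvd_C_X_mul (Ideal.mem_span_singleton.mp hs))
  have hw : ∀ k, l (toLocalizedQuotient J _ k) = wittEval w k := fun k => congrArg (fun g => g k) hl
  have hlq : l (toLocalizedQuotient J _ q) = 0 := by
    rw [hw]
    obtain ⟨a, b, hab⟩ := Ideal.mem_span_pair.mp hmem
    rw [← hab, map_add, map_mul, map_mul, map_pow, map_pow, map_natCast, wittEval_X, hp, h0]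
    simp
  rw [← hq, map_mul, map_pow, hw, wittEval_C_X] at hlq
  exact (h1.pow r).mul_left_eq_zero.mp hlq

end LocalizedQuotient

/-! ### Sections of torsors and points of `Σ` -/

section SigmaSections

variable {p : ℕ} [Fact p.Prime]

/-- The `T`-point of `Σ` defined by a primitive Witt vector. -/
noncomputable abbrev sigmaPoint {T : Scheme.{u}} (w : Witt p T) (hw : IsPrimitive w) :
    SigmaStack.{u} p :=
  (quotientMap p).obj ⟨T, w, hw⟩

lemma WittTorsor.π_map {S : Scheme.{u}} (P : WittTorsor.{u} p S) {T U : Scheme.{u}} (f : U ⟶ T)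
    (a : P.P.obj (op T)) : P.π.app (op U) (P.P.map f.op a) = f ≫ P.π.app (op T) a :=
  congrArg (fun h => h a) (P.π.naturality f.op)

lemma SigmaStack.Hom.π_map_app {x' x : SigmaStack.{u} p} (g : SigmaStack.Hom x' x) {T : Scheme.{u}}
    (b : x'.torsor.P.obj (op T)) :
    x.torsor.π.app (op T) (g.map.app (op T) b) = x'.torsor.π.app (op T) b ≫ g.hom :=
  congrArg (fun h => h.app (op T) b) g.map_π

/-- A section `a` over `f : T ⟶ S` of the torsor underlying an `S`-point `x` of `Σ` defines a
morphism over `f` from the image of `ξ a` in `Σ` to `x`. -/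
noncomputable def sigmaPointHom {x : SigmaStack.{u} p} {T : Scheme.{u}} (f : T ⟶ x.base)
    (a : x.torsor.P.obj (op T)) (ha : x.torsor.π.app (op T) a = f) :
    sigmaPoint (x.ξ a) (x.ξ_isPrimitive a) ⟶ x where
  hom := f
  map := { app := fun U => TypeCat.ofHom fun c => x.torsor.smul c.2 (x.torsor.P.map c.1.op a)
           naturality := fun U V g => by
            ext c
            refine Eq.trans ?_ (x.torsor.map_smul g.unop c.2 (x.torsor.P.map c.1.op a)).symm
            change x.torsor.smul _ (x.torsor.P.map (g.unop ≫ c.1).op a) =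
              x.torsor.smul _ (x.torsor.P.map g (x.torsor.P.map c.1.op a))
            rw [op_comp, Functor.map_comp]
            rfl }
  map_π := by
    ext U c
    refine (x.torsor.π_smul c.2 _).trans ?_
    rw [x.torsor.π_map, ha]
    rfl
  map_smul l c := x.torsor.mul_smul l c.2 _
  map_ξ c := by
    refine (x.ξ_smul c.2 _).trans ?_
    rw [x.ξ_map]
    rfl

/-- If `a` is a section over `S' ⟶ S` of the torsor underlying an `S`-point `x` of `Σ`, a
morphism `x' ⟶ x` over `S' ⟶ S` yields a morphism from `x'` to the image of `ξ a` in `Σ`. -/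
lemma nonempty_hom_sigmaPoint {x' x : SigmaStack.{u} p} (g : x' ⟶ x)
    (a : x.torsor.P.obj (op x'.base)) (ha : x.torsor.π.app (op x'.base) a = SigmaStack.Hom.hom g) :
    Nonempty (x' ⟶ sigmaPoint (x.ξ a) (x.ξ_isPrimitive a)) := by
  -- The section `a` trivializes the pulled-back torsor: `l b` is the coordinate of the image of `b`
  -- relative to `a`. Its uniqueness gives naturality and equivariance.
  have h : ∀ {T : Scheme.{u}} (b : x'.torsor.P.obj (op T)), ∃! l : (Witt p T)ˣ,
      x.torsor.smul l (x.torsor.P.map (x'.torsor.π.app (op T) b).op a) =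
        (SigmaStack.Hom.map g).app (op T) b := fun {T} b =>
    x.torsor.simply_transitive _ _ (by
      rw [x.torsor.π_map, ha, SigmaStack.Hom.π_map_app])
  choose l hl hl' using @h
  exact ⟨{
    hom := 𝟙 _
    map := { app := fun U => TypeCat.ofHom fun b => (x'.torsor.π.app U b, l b)
             naturality := by
              rintro ⟨U⟩ ⟨V⟩ f
              obtain ⟨f, rfl⟩ : ∃ k, f = Quiver.Hom.op k := ⟨f.unop, rfl⟩
              ext b
              refine Prod.ext (x'.torsor.π_map f b) (hl' (x'.torsor.P.map f.op b)
                (Witt.pullbackUnits f (l b)) ?_).symm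
              change x.torsor.smul _ _ = _
              rw [x'.torsor.π_map f b, op_comp, Functor.map_comp]
              refine (x.torsor.map_smul f (l b) _).symm.trans ?_
              refine (congrArg (x.torsor.P.map f.op) (hl b)).trans ?_
              exact (congrArg (fun h => h b) ((SigmaStack.Hom.map g).naturality f.op)).symm }
    map_π := rfl
    map_smul := fun {T} m b => by
      refine Prod.ext (x'.torsor.π_smul m b) (hl' (x'.torsor.smul m b) (m * l b) ?_).symm
      change x.torsor.smul _ _ = _
      rw [x'.torsor.π_smul, x.torsor.mul_smul, hl b, SigmaStack.Hom.map_smul]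
    map_ξ := fun {T} b => by
      have h1 := (SigmaStack.Hom.map_ξ g b).symm.trans (congrArg x.ξ (hl b)).symm
      rw [x.ξ_smul, x.ξ_map] at h1
      exact h1.symm }⟩

end SigmaSections

/-! ### Reduction to affine schemes -/

section ClosedSubstacks

variable {p : ℕ} [Fact p.Prime]

/-- The morphism in `Σ` defined by a morphism of test schemes. -/
noncomputable def sigmaPointMap {T U : Scheme.{u}} (f : U ⟶ T) {w : Witt p T} (hw : IsPrimitive w)
    {v : Witt p U} (hv : IsPrimitive v) (h : Witt.pullback f w = v) :
    sigmaPoint v hv ⟶ sigmaPoint w hw :=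
  (quotientMap p).map (X := ⟨U, v, hv⟩) (Y := ⟨T, w, hw⟩) ⟨f, h⟩

lemma sigmaPoint_congr {T : Scheme.{u}} {w v : Witt p T} (h : w = v) (hw : IsPrimitive w)
    (hv : IsPrimitive v) : sigmaPoint w hw = sigmaPoint v hv := by
  subst h
  rfl

/-- Multiplication by a unit does not change the point of `Σ` defined by a primitive Witt vector. -/
lemma nonempty_sigmaPoint_units_mul {T : Scheme.{u}} {w v : Witt p T} (hw : IsPrimitive w)
    (hv : IsPrimitive v) (l : (Witt p T)ˣ) (h : v = l * w) :
    Nonempty (sigmaPoint v hv ⟶ sigmaPoint w hw) := by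
  have := sigmaPointHom (x := sigmaPoint w hw) (𝟙 T) (show _ × _ from (𝟙 T, l)) rfl
  have h' : (sigmaPoint w hw).ξ (T := T) (show _ × _ from (𝟙 T, l)) = v := by
    change (l : Witt p T) * Witt.pullback (𝟙 T) w = v
    rw [Witt.pullback_id, h]
  subst h'
  exact ⟨this⟩

/-- The locality axiom quantifies over all objects above the cover. The unit section of the trivial
torsor maps each of them to the point given by a pullback of `w`, so these points suffice. -/
lemma sigmaPoint_mem_of_cover (Y : ClosedSubstack (SigmaStack.toScheme.{u} p)) {T : Scheme.{u}}
    {w : Witt p T} (hw : IsPrimitive w) {R : Sieve T} (hR : R ∈ Scheme.fpqcTopology T)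
    (h : ∀ (U : Scheme.{u}) (f : U ⟶ T), R f → Y.mem (sigmaPoint _ (hw.pullback f))) :
    Y.mem (sigmaPoint w hw) := by
  refine Y.mem_of_cover _ R hR fun x' g hg => ?_
  have hx := nonempty_hom_sigmaPoint g
    (show _ × _ from (SigmaStack.Hom.hom g, (1 : (Witt p x'.base)ˣ))) rfl
  have e : (sigmaPoint w hw).ξ (T := x'.base)
      (show _ × _ from (SigmaStack.Hom.hom g, (1 : (Witt p x'.base)ˣ))) =
        Witt.pullback (SigmaStack.Hom.hom g) w := one_mul _
  obtain ⟨k⟩ := hx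
  refine Y.mem_of_hom k ?_
  rw [sigmaPoint_congr e _ (hw.pullback _)]
  exact h _ _ hg

/-- Two localizations: an fpqc cover trivializing the torsor, then a Zariski cover by affines. -/
lemma mem_eq_top_of_affine (𝒴 : ClosedSubstack (SigmaStack.toScheme.{u} p))
    (h : ∀ (R : CommRingCat.{u}) (w : Witt p (Spec R)) (hw : IsPrimitive w),
      𝒴.mem (sigmaPoint w hw)) : 𝒴.mem = ⊤ := by
  refine eq_top_iff.mpr fun x _ => ?_
  obtain ⟨R, hR, hx⟩ := x.torsor.locally_nonempty
  refine 𝒴.mem_of_cover x R hR fun x' g hg => ?_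
  obtain ⟨a, ha⟩ := hx _ _ hg
  obtain ⟨k⟩ := nonempty_hom_sigmaPoint g a ha
  refine 𝒴.mem_of_hom k ?_
  let 𝒰 := Scheme.affineCover x'.base
  refine sigmaPoint_mem_of_cover 𝒴 _ (R := Sieve.generate 𝒰.presieve₀)
    (Scheme.zariskiTopology_le_fpqcTopology _ (Precoverage.generate_mem_toGrothendieck 𝒰.mem₀)) ?_
  rintro _ _ ⟨_, f, _, ⟨i⟩, rfl⟩
  exact 𝒴.mem_of_hom (sigmaPointMap f ((x.ξ_isPrimitive a).pullback (𝒰.f i)) _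
    (Witt.pullback_comp _ _ _).symm) (h _ _ _)

end ClosedSubstacks

/-! ### Morphisms to affine schemes -/

section SpecHom

variable {T : Scheme.{u}} {E : Type u} [CommRing E]

/-- The morphism to an affine scheme defined by a ring homomorphism. -/
noncomputable def specHom (l : E →+* Γ(T, ⊤)) : T ⟶ Spec (CommRingCat.of E) :=
  T.toSpecΓ ≫ Spec.map (CommRingCat.ofHom l)

/-- The global function on `Spec E` defined by an element of `E`. -/
noncomputable abbrev specFun : E →+* Γ(Spec (CommRingCat.of E), ⊤) :=
  (Scheme.ΓSpecIso (CommRingCat.of E)).inv.hom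

lemma specHom_appTop (l : E →+* Γ(T, ⊤)) (e : E) : (specHom l).appTop (specFun e) = l e := by
  have h : (Scheme.ΓSpecIso (CommRingCat.of E)).inv ≫ (specHom l).appTop =
      CommRingCat.ofHom l := by
    rw [specHom, Scheme.Hom.comp_appTop, Scheme.toSpecΓ_appTop, ← Category.assoc,
      ← Scheme.ΓSpecIso_inv_naturality, Category.assoc, Iso.inv_hom_id, Category.comp_id]
  exact congrArg (fun k => k.hom e) h

lemma specHom_comp_specMap {F : Type u} [CommRing F] (l : F →+* Γ(T, ⊤)) (g : E →+* F) :
    specHom l ≫ Spec.map (CommRingCat.ofHom g) = specHom (l.comp g) := by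
  rw [specHom, specHom, Category.assoc, ← Spec.map_comp]
  rfl

lemma specMap_appTop_specFun {F : Type u} [CommRing F] (g : E →+* F) (e : E) :
    (Spec.map (CommRingCat.ofHom g)).appTop (specFun e) = specFun (g e) := by
  have h := Scheme.ΓSpecIso_inv_naturality (CommRingCat.ofHom g)
  exact (congrArg (fun k => k.hom e) h).symm

lemma exists_specHom_eq_comp_iff {Z : Scheme.{u}} (i : Z ⟶ Spec (CommRingCat.of E))
    [IsClosedImmersion i] : ∃ I : Ideal E, ∀ (T : Scheme.{u}) (l : E →+* Γ(T, ⊤)),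
      (∃ h : T ⟶ Z, h ≫ i = specHom l) ↔ ∀ f ∈ I, l f = 0 := by
  obtain ⟨I, e, he⟩ := IsClosedImmersion.Spec_iff.mp ‹IsClosedImmersion i›
  refine ⟨I, fun T l => ⟨?_, fun hl => ?_⟩⟩
  · rintro ⟨h, hh⟩ f hf
    rw [← specHom_appTop l, ← hh, he, ← Category.assoc, Scheme.Hom.comp_appTop]
    have := specMap_appTop_specFun (Ideal.Quotient.mk I) f
    rw [Ideal.Quotient.eq_zero_iff_mem.mpr hf, map_zero] at this
    exact (congrArg (h ≫ e.hom).appTop.hom this).trans (map_zero _)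
  · refine ⟨specHom (Ideal.Quotient.lift I l hl) ≫ e.inv, ?_⟩
    rw [he, Category.assoc, Iso.inv_hom_id_assoc]
    exact specHom_comp_specMap (Ideal.Quotient.lift I l hl) (Ideal.Quotient.mk I)

end SpecHom

/-! ### Nilpotent functions on quasi-compact schemes -/

section Nilpotent

lemma IsLocallyNilpotent.of_isNilpotent {S : Scheme.{u}} {s : Γ(S, ⊤)} (hs : IsNilpotent s) :
    IsLocallyNilpotent s :=
  fun _ => ⟨⊤, trivial, hs.map (S.presheaf.map (homOfLE le_top).op).hom⟩

lemma IsLocallyNilpotent.isNilpotent {S : Scheme.{u}} [CompactSpace S] {s : Γ(S, ⊤)}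
    (hs : IsLocallyNilpotent s) : IsNilpotent s := by
  rw [Scheme.isNilpotent_iff_basicOpen_eq_bot]
  refine eq_bot_iff.mpr fun x hx => ?_
  obtain ⟨U, hxU, hU⟩ := hs x
  rw [S.mem_basicOpen_top] at hx
  have h1 : IsNilpotent (S.presheaf.germ ⊤ x trivial s) := by
    have := hU.map (S.presheaf.germ U x hxU).hom
    convert this using 1
    exact (TopCat.Presheaf.germ_res_apply S.presheaf (homOfLE le_top) x hxU s).symm
  exact (h1.not_isUnit hx).elim

lemma isPrimitive_of_isNilpotent {p : ℕ} {S : Scheme.{u}} {w : Witt p S} (hp : IsNilpotent (p : Γ(S, ⊤)))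
    (h0 : IsNilpotent (w.coeff 0)) (h1 : IsUnit (w.coeff 1)) : IsPrimitive w :=
  ⟨.of_isNilpotent hp, .of_isNilpotent h0, h1⟩

end Nilpotent

/-! ### Density of the point `p` -/

section Density

open Polynomial

variable {p : ℕ} [Fact p.Prime]

/-- The tautological Witt vector over `WittPoly`. -/
noncomputable def tautologicalVector (p : ℕ) : WittVector p WittPoly :=
  WittVector.mk p fun n => Nat.casesOn n X fun n => C (MvPolynomial.X n)

lemma map_wittEval_tautologicalVector {R : Type*} [CommRing R] (w : WittVector p R) :
    WittVector.map (wittEval w) (tautologicalVector p) = w := by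
  ext n
  cases n with
  | zero => exact wittEval_X w
  | succ n => exact wittEval_C_X w n

lemma witt_map_comp {R S U : Type*} [CommRing R] [CommRing S] [CommRing U] (f : R →+* S)
    (g : S →+* U) (w : WittVector p R) :
    WittVector.map g (WittVector.map f w) = WittVector.map (g.comp f) w := by
  ext n
  rfl

lemma pullback_specHom {T : Scheme.{u}} {E : Type u} [CommRing E] (l : E →+* Γ(T, ⊤))
    (v : WittVector p E) :
    Witt.pullback (specHom l) (WittVector.map specFun v) = WittVector.map l v := by
  ext n
  exact specHom_appTop l (v.coeff n)

/-- A Witt vector over `WittPoly` becomes a multiple of `p` by a unit at `p u + [p² X]`, once `p` is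
nilpotent and `u₀` is invertible. -/
lemma exists_map_genericMultiple_eq {R : Type u} [CommRing R] (d : WittPoly →+* R)
    (hp : IsNilpotent (p : R)) (hd : IsUnit (d (C (MvPolynomial.X 0)))) :
    ∃ l : (WittVector p R)ˣ, WittVector.map d (genericMultiple p) = l * (p : WittVector p R) := by
  obtain ⟨ν, hν, hν0⟩ := exists_genericMultiple_eq (p := p)
  have hνu : IsUnit (WittVector.map d ν) := by
    refine isUnit_of_isUnit_coeff_zero hp ?_
    rw [WittVector.map_coeff, hν0, map_add, map_mul, map_natCast]
    exact (Commute.isNilpotent_mul_right (Commute.all _ _) hp).isUnit_add_left_of_commute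
      hd (Commute.all _ _)
  obtain ⟨l, hl⟩ := hνu
  exact ⟨l, by rw [hν, map_mul, map_natCast, mul_comm, hl]⟩

/-- The ideal of a closed substack in the base of a point of `Σ` defined by a homomorphism
`WittPoly → E`. -/
lemma ClosedSubstack.exists_ideal (Y : ClosedSubstack (SigmaStack.toScheme.{u} p)) {E : Type u}
    [CommRing E] (φ : WittPoly →+* E) (hp : IsNilpotent (p : E)) (h0 : IsNilpotent (φ X))
    (h1 : IsUnit (φ (C (MvPolynomial.X 0)))) :
    ∃ I : Ideal E, ∀ (T : Scheme.{u}) (w : Witt p T) (hw : IsPrimitive w) (l : E →+* Γ(T, ⊤)),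
      l.comp φ = wittEval w → (Y.mem (sigmaPoint w hw) ↔ ∀ f ∈ I, l f = 0) := by
  let v : Witt p (Spec (CommRingCat.of E)) :=
    WittVector.map specFun (WittVector.map φ (tautologicalVector p))
  have hv : IsPrimitive v := by
    refine isPrimitive_of_isNilpotent ?_ (h0.map specFun) (h1.map specFun)
    have := hp.map (specFun (E := E))
    rwa [map_natCast] at this
  obtain ⟨Z, i, hi, hZ⟩ := Y.closed (sigmaPoint v hv)
  obtain ⟨I, hI⟩ := @exists_specHom_eq_comp_iff E _ Z i hi
  refine ⟨I, fun T w hw l hl => ?_⟩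
  have hlw : Witt.pullback (specHom l) v = w := by
    rw [pullback_specHom, witt_map_comp, hl, map_wittEval_tautologicalVector]
  rw [← hI T l]
  exact hZ _ (sigmaPointMap (specHom l) hv hw hlw)

lemma ClosedSubstack.FactorsThrough.mem_sigmaPoint {Y : ClosedSubstack (SigmaStack.toScheme.{u} p)}
    (hY : Y.FactorsThrough (sigmaPointP.{u} p)) {T : Scheme.{u}} {w : Witt p T}
    (hw : IsPrimitive w) (l : (Witt p T)ˣ) (hl : w = l * (p : Witt p T)) :
    Y.mem (sigmaPoint w hw) := by
  obtain ⟨k⟩ := nonempty_sigmaPoint_units_mul (isPrimitive_p hw.isPNilpotent) hw l hl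
  exact Y.mem_of_hom k (hY ⟨T, hw.isPNilpotent⟩)

lemma specFun_injective {D : Type u} [CommRing D] : Function.Injective (specFun (E := D)) :=
  (Scheme.ΓSpecIso (CommRingCat.of D)).symm.commRingCatIsoToRingEquiv.injective

lemma isPrimitive_map_genericMultiple {S : Scheme.{u}} (d : WittPoly →+* Γ(S, ⊤))
    (hp : IsNilpotent (p : Γ(S, ⊤))) (hd : IsUnit (d (C (MvPolynomial.X 0)))) :
    IsPrimitive (WittVector.map d (genericMultiple p)) := by
  obtain ⟨ν, hν⟩ := exists_map_genericMultiple_eq d hp hd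
  rw [hν]
  exact (isPrimitive_p (.of_isNilpotent hp)).units_mul _

/-- The vector is a unit multiple of the primitive vector `p`, so its component of index `1` need
not be computed. -/
lemma isUnit_map_genericMultiple_coeff_one {D : Type u} [CommRing D] (ψ : WittPoly →+* D)
    (hp : IsNilpotent (p : D)) (hψ : IsUnit (ψ (C (MvPolynomial.X 0)))) :
    IsUnit ((WittVector.map ψ (genericMultiple p)).coeff 1) := by
  have hp' : IsNilpotent (p : Γ(Spec (CommRingCat.of D), ⊤)) := by
    have := hp.map (specFun (E := D))
    rwa [map_natCast] at this
  have := (isPrimitive_map_genericMultiple (specFun.comp ψ) hp' (hψ.map specFun)).coeff_one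
  exact (isUnit_map_iff (Scheme.ΓSpecIso (CommRingCat.of D)).symm.commRingCatIsoToRingEquiv _).mp
    this

lemma ClosedSubstack.FactorsThrough.eq_zero_of_mem_ideal
    {Y : ClosedSubstack (SigmaStack.toScheme.{u} p)}
    (hY : Y.FactorsThrough (sigmaPointP.{u} p)) {E D : Type u} [CommRing E] [CommRing D]
    {φ : WittPoly →+* E} {I : Ideal E}
    (hI : ∀ (T : Scheme.{u}) (w : Witt p T) (hw : IsPrimitive w) (l : E →+* Γ(T, ⊤)),
      l.comp φ = wittEval w → (Y.mem (sigmaPoint w hw) ↔ ∀ f ∈ I, l f = 0))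
    (ψ : WittPoly →+* D) (hp : IsNilpotent (p : D)) (hψ : IsUnit (ψ (C (MvPolynomial.X 0))))
    (t : E →+* D) (ht : t.comp φ = ψ.comp (wittEval (genericMultiple p))) {f : E} (hf : f ∈ I) :
    t f = 0 := by
  have hp' : IsNilpotent (p : Γ(Spec (CommRingCat.of D), ⊤)) := by
    have := hp.map (specFun (E := D))
    rwa [map_natCast] at this
  have hprim := isPrimitive_map_genericMultiple (specFun.comp ψ) hp' (hψ.map specFun)
  obtain ⟨ν, hν⟩ := exists_map_genericMultiple_eq (specFun.comp ψ) hp' (hψ.map specFun)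
  have := (hI _ _ hprim (specFun.comp t) (by
    rw [RingHom.comp_assoc, ht, ← comp_wittEval, RingHom.comp_assoc])).mp
    (hY.mem_sigmaPoint hprim ν hν) f hf
  exact specFun_injective (this.trans (map_zero _).symm)

/-- A closed substack of `Σ` which contains the image of `p : Spf ℤ_p ⟶ Σ` contains all points given by
primitive Witt vectors over quasi-compact schemes. -/
theorem ClosedSubstack.FactorsThrough.mem_sigmaPoint_of_compactSpace
    {Y : ClosedSubstack (SigmaStack.toScheme.{u} p)} (hY : Y.FactorsThrough (sigmaPointP.{u} p))
    {T : Scheme.{u}} [CompactSpace T] (w : Witt p T) (hw : IsPrimitive w) :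
    Y.mem (sigmaPoint w hw) := by
  obtain ⟨m, hpm, h0m⟩ : ∃ m, (p : Γ(T, ⊤)) ^ m = 0 ∧ w.coeff 0 ^ m = 0 := by
    obtain ⟨a, ha⟩ := IsLocallyNilpotent.isNilpotent hw.isPNilpotent
    obtain ⟨b, hb⟩ := hw.coeff_zero.isNilpotent
    exact ⟨max a b, pow_eq_zero_of_le (le_max_left a b) ha, pow_eq_zero_of_le (le_max_right a b) hb⟩
  -- The localized quotient by `J` must receive both tests: `w`, for which the exponent `m` would
  -- do, and `p u + [p² X]` modulo `p ^ (6m)`, whose zeroth component is a multiple of `p` and so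
  -- dies only in the power `6m`.
  let J : Ideal WittPoly := Ideal.span {(p : WittPoly) ^ (6 * m), X ^ (6 * m)}
  have hJ : ∀ {R : Type u} [CommRing R] (v : WittVector p R), (p : R) ^ (6 * m) = 0 →
      v.coeff 0 ^ (6 * m) = 0 → ∀ q ∈ J, wittEval v q = 0 := by
    intro R _ v hp h0 q hq
    obtain ⟨a, b, rfl⟩ := Ideal.mem_span_pair.mp hq
    simp [hp, h0]
  obtain ⟨I, hI⟩ := Y.exists_ideal (toLocalizedQuotient.{u} J (C (MvPolynomial.X 0)))
    ⟨6 * m, by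
      rw [← map_natCast (toLocalizedQuotient J (C (MvPolynomial.X 0))), ← map_pow]
      exact toLocalizedQuotient_eq_zero (Ideal.subset_span (by simp))⟩
    ⟨6 * m, by
      rw [← map_pow]
      exact toLocalizedQuotient_eq_zero (Ideal.subset_span (by simp))⟩
    isUnit_toLocalizedQuotient
  obtain ⟨l, hl⟩ := exists_localizedQuotient_lift.{u} (J := J) (a := C (MvPolynomial.X 0))
    (wittEval w)
    (hJ w (pow_eq_zero_of_le (by omega) hpm) (pow_eq_zero_of_le (by omega) h0m))
    (by rw [wittEval_C_X]; exact hw.coeff_one)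
  refine (hI T w hw l hl).mpr fun f hf => ?_
  have hpD : (p : LocalizedQuotient.{u} (Ideal.span {(p : WittPoly) ^ (6 * m)})
      (C (MvPolynomial.X 0))) ^ (6 * m) = 0 := by
    rw [← map_natCast (toLocalizedQuotient _ _), ← map_pow,
      toLocalizedQuotient_eq_zero (Ideal.mem_span_singleton_self _)]
  obtain ⟨t, ht⟩ := exists_localizedQuotient_lift.{u} (J := J) (a := C (MvPolynomial.X 0))
    (wittEval (WittVector.map (toLocalizedQuotient.{u} (Ideal.span {(p : WittPoly) ^ (6 * m)})
      (C (MvPolynomial.X 0))) (genericMultiple p)))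
    (hJ _ hpD (by
      rw [WittVector.map_coeff, genericMultiple_coeff_zero, map_mul, map_natCast, mul_pow, hpD,
        zero_mul]))
    (by
      rw [wittEval_C_X]
      exact isUnit_map_genericMultiple_coeff_one _ ⟨_, hpD⟩ isUnit_toLocalizedQuotient)
  rw [← comp_wittEval] at ht
  exact eq_zero_of_localizedQuotient l hl hpm h0m hw.coeff_one t ht
    (hY.eq_zero_of_mem_ideal hI _ ⟨_, hpD⟩ isUnit_toLocalizedQuotient t ht hf)

/-- A closed substack of `Σ` which contains the image of `p : Spf ℤ_p ⟶ Σ` is equal to `Σ`. -/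
theorem mem_eq_top_of_factorsThrough (Y : ClosedSubstack (SigmaStack.toScheme.{u} p))
    (hY : Y.FactorsThrough (sigmaPointP.{u} p)) : Y.mem = ⊤ :=
  mem_eq_top_of_affine Y fun _ w hw => hY.mem_sigmaPoint_of_compactSpace w hw

end Density

/-! ### The zero locus of a global function -/

section ZeroLocus

variable {p : ℕ} [Fact p.Prime]

/-- Global functions on schemes are separated for the fpqc topology. -/
lemma eq_zero_of_cover (p : ℕ) [Fact p.Prime] {T : Scheme.{u}} {R : Sieve T} (hR : R ∈ Scheme.fpqcTopology T)
    {t : Γ(T, ⊤)} (h : ∀ (U : Scheme.{u}) (f : U ⟶ T), R f → f.appTop t = 0) : t = 0 := by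
  obtain ⟨v, -, hv⟩ := witt_glue (p := p) hR (fun U _ _ => 0) fun U V f hf g => map_zero _
  -- The Teichmüller lift carries separatedness from `W` to the structure sheaf.
  have h1 : WittVector.teichmuller p t = (0 : Witt p T) :=
    (hv _ fun U f hf => by
      refine (WittVector.map_teichmuller p f.appTop.hom t).trans ?_
      rw [show f.appTop.hom t = 0 from h U f hf, WittVector.teichmuller_zero]).trans
    (hv _ fun U f hf => map_zero _).symm
  rw [← WittVector.teichmuller_coeff_zero p t, h1, WittVector.zero_coeff]

lemma exists_closedImmersion_zeroLocus {S : Scheme.{u}} (t : Γ(S, ⊤)) :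
    ∃ (Z : Scheme.{u}) (i : Z ⟶ S), IsClosedImmersion i ∧
      ∀ (T : Scheme.{u}) (f : T ⟶ S), f.appTop t = 0 ↔ ∃ h : T ⟶ Z, h ≫ i = f := by
  let j := Spec.map (CommRingCat.ofHom (Ideal.Quotient.mk (Ideal.span {t})))
  refine ⟨Limits.pullback S.toSpecΓ j, Limits.pullback.fst _ _, inferInstance, fun T f => ?_⟩
  have hf : f ≫ S.toSpecΓ = specHom f.appTop.hom := Scheme.toSpecΓ_naturality f
  constructor
  · intro h
    have hI : ∀ a ∈ Ideal.span {t}, f.appTop.hom a = 0 := fun a ha => by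
      obtain ⟨b, rfl⟩ := Ideal.mem_span_singleton'.mp ha
      rw [map_mul, show f.appTop.hom t = 0 from h, mul_zero]
    have hl : f ≫ S.toSpecΓ = specHom (Ideal.Quotient.lift (Ideal.span {t}) f.appTop.hom hI) ≫ j :=
      hf.trans (specHom_comp_specMap (Ideal.Quotient.lift (Ideal.span {t}) f.appTop.hom hI)
        (Ideal.Quotient.mk (Ideal.span {t}))).symm
    exact ⟨Limits.pullback.lift f _ hl, Limits.pullback.lift_fst _ _ _⟩
  · rintro ⟨h, rfl⟩
    refine (specHom_appTop (h ≫ Limits.pullback.fst S.toSpecΓ j).appTop.hom t).symm.trans ?_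
    rw [← hf, Category.assoc, Limits.pullback.condition, ← Category.assoc, Scheme.Hom.comp_appTop]
    have := specMap_appTop_specFun (Ideal.Quotient.mk (Ideal.span {t})) t
    rw [Ideal.Quotient.eq_zero_iff_mem.mpr (Ideal.mem_span_singleton_self t), map_zero] at this
    exact (congrArg (h ≫ Limits.pullback.snd S.toSpecΓ j).appTop.hom this).trans (map_zero _)

/-- The closed substack of `Σ` defined by the vanishing of a global function. -/
noncomputable def sigmaZeroLocus (s : globalFunctions (SigmaStack.toScheme.{u} p)) :
    ClosedSubstack (SigmaStack.toScheme.{u} p) where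
  mem x := s.1 x = 0
  mem_of_hom {x' x} g hx := by
    rw [← s.2 g, hx, map_zero]
  mem_of_cover x R hR h := by
    obtain ⟨R', hR', hx⟩ := x.torsor.locally_nonempty
    -- The hypothesis concerns objects of Σ, not schemes over the base. Where the torsor has a
    -- section, `sigmaPointHom` supplies an object above the given morphism.
    refine eq_zero_of_cover p (GrothendieckTopology.intersection_covering _ hR hR') ?_
    rintro U f ⟨hf, hf'⟩
    obtain ⟨a, ha⟩ := hx U f hf'
    exact (s.2 (sigmaPointHom f a ha)).trans (h _ (sigmaPointHom f a ha) hf)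
  closed x := by
    obtain ⟨Z, i, hi, h⟩ := exists_closedImmersion_zeroLocus (s.1 x)
    refine ⟨Z, i, hi, fun x' g => ?_⟩
    rw [← h, s.2 g]

/-- A global function on `Σ` which vanishes on `p : Spf ℤ_p ⟶ Σ` is zero. -/
theorem globalFunctions_eq_zero {s : globalFunctions (SigmaStack.toScheme.{u} p)}
    (hs : ∀ S : SpfZp.{u} p, s.1 ((sigmaPointP p).obj S) = 0) : s = 0 := by
  have h := mem_eq_top_of_factorsThrough (sigmaZeroLocus s) hs
  refine Subtype.ext (funext fun x => ?_)
  have hx : (sigmaZeroLocus s).mem x := by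
    rw [h]
    trivial
  exact hx

end ZeroLocus

/-! ### Global functions on `Spf ℤ_p` -/

section SpfZpFunctions

variable {p : ℕ} [Fact p.Prime]

variable (p) in
/-- The scheme `Spec ℤ/pⁿ`. -/
noncomputable abbrev specZModPow (n : ℕ) : Scheme.{u} :=
  Spec (CommRingCat.of (ULift.{u} (ZMod (p ^ n))))

lemma specZModPow_natCast_pow {p : ℕ} (n : ℕ) : (p : Γ(specZModPow.{u} p n, ⊤)) ^ n = 0 := by
  have h : (p : ZMod (p ^ n)) ^ n = 0 := by
    rw [← Nat.cast_pow, ZMod.natCast_self]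
  have := congrArg ((specFun (E := ULift.{u} (ZMod (p ^ n)))).comp
    ULift.ringEquiv.symm.toRingHom) h
  rwa [map_pow, map_natCast, map_zero] at this

lemma isPNilpotent_of_pow_eq_zero {p : ℕ} {S : Scheme.{u}} {n : ℕ} (h : (p : Γ(S, ⊤)) ^ n = 0) :
    IsPNilpotent p S :=
  .of_isNilpotent ⟨n, h⟩

lemma padicIntToSigma_injective : Function.Injective (padicIntToSigma.{u} p) := by
  rw [injective_iff_map_eq_zero]
  intro a ha
  refine PadicInt.ext_of_toZModPow.mp fun n => ?_
  rw [map_zero]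
  have hS := isPNilpotent_of_pow_eq_zero (specZModPow_natCast_pow.{u} (p := p) n)
  have h1 : padicIntToSections p hS a = 0 :=
    congrArg (fun s => s.1 ((sigmaPointP p).obj ⟨_, hS⟩)) ha
  rw [padicInt_hom_sections_ext p hS (padicIntToSections p hS)
    ((specFun.comp ULift.ringEquiv.symm.toRingHom).comp (PadicInt.toZModPow n))] at h1
  exact ULift.ringEquiv.symm.injective
    ((specFun_injective (h1.trans (map_zero _).symm)).trans (map_zero _).symm)

lemma exists_padicInt_of_compatible (z : ℕ → ℤ) (hz : ∀ n, (p : ℤ) ^ n ∣ z (n + 1) - z n) :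
    ∃ a : ℤ_[p], ∀ n, (p : ℤ_[p]) ^ n ∣ a - z n := by
  have hz' : ∀ m n, m ≤ n → (p : ℤ_[p]) ^ m ∣ z n - z m := fun m n hmn => by
    induction n, hmn using Nat.le_induction with
    | base => simp
    | succ n hmn ih =>
      have h : (p : ℤ_[p]) ^ n ∣ z (n + 1) - z n := by
        have := map_dvd (Int.castRingHom ℤ_[p]) (hz n)
        simpa using this
      have := dvd_add ((pow_dvd_pow _ hmn).trans h) ih
      rwa [sub_add_sub_cancel] at this
  obtain ⟨a, ha⟩ := IsPrecomplete.prec (I := IsLocalRing.maximalIdeal ℤ_[p]) (M := ℤ_[p])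
    inferInstance (f := fun n => (z n : ℤ_[p])) (by
      intro m n hmn
      rw [SModEq.sub_mem, PadicInt.maximalIdeal_eq_span_p, Ideal.span_singleton_pow, smul_eq_mul,
        Ideal.mul_top, Ideal.mem_span_singleton, ← neg_sub, dvd_neg]
      exact hz' m n hmn)
  refine ⟨a, fun n => ?_⟩
  have := ha n
  rwa [SModEq.sub_mem, PadicInt.maximalIdeal_eq_span_p, Ideal.span_singleton_pow, smul_eq_mul,
    Ideal.mul_top, Ideal.mem_span_singleton, ← neg_sub, dvd_neg] at this

/-- Every global function on `Spf ℤ_p` is given by an element of `ℤ_p`. -/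
theorem exists_eq_padicIntToSections (s : globalFunctions (SpfZp.toScheme.{u} p)) :
    ∃ a : ℤ_[p], ∀ S : SpfZp.{u} p, s.1 S = padicIntToSections p S.property a := by
  let S : ℕ → SpfZp.{u} p := fun n =>
    ⟨specZModPow p n, isPNilpotent_of_pow_eq_zero (specZModPow_natCast_pow n)⟩
  have hz : ∀ n, ∃ z : ℤ, s.1 (S n) = (z : Γ(specZModPow.{u} p n, ⊤)) := fun n => by
    obtain ⟨e, he⟩ := (Scheme.ΓSpecIso (CommRingCat.of
      (ULift.{u} (ZMod (p ^ n))))).symm.commRingCatIsoToRingEquiv.surjective (s.1 (S n))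
    obtain ⟨z, hz⟩ := ZMod.intCast_surjective (ULift.ringEquiv e)
    refine ⟨z, ?_⟩
    have : e = (z : ULift.{u} (ZMod (p ^ n))) := ULift.ringEquiv.injective (by rw [← hz, map_intCast])
    rw [← he, this]
    exact map_intCast _ _
  choose z hz using hz
  -- A scheme on which `p ^ n = 0` maps to `Spec ℤ/pⁿ`, so the value there is pulled back from the
  -- integer `z n`.
  have key : ∀ (n : ℕ) (U : SpfZp.{u} p), (p : Γ(U.obj, ⊤)) ^ n = 0 →
      s.1 U = (z n : Γ(U.obj, ⊤)) := fun n U hU => by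
    have hchar : ringChar Γ(U.obj, ⊤) ∣ p ^ n := ringChar.dvd (by exact_mod_cast hU)
    let f : U ⟶ S n := ⟨specHom ((ZMod.castHom hchar Γ(U.obj, ⊤)).comp ULift.ringEquiv.toRingHom)⟩
    have := s.2 f
    rw [hz] at this
    exact this.symm.trans (map_intCast _ _)
  obtain ⟨a, ha⟩ := exists_padicInt_of_compatible (p := p) z fun n => by
    -- On `Spec ℤ/pⁿ` also `p ^ (n + 1) = 0`, so `z n` and `z (n + 1)` both represent the value
    -- there.
    have h1 := key (n + 1) (S n) (by rw [pow_succ]; exact (congrArg (· * _)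
      (specZModPow_natCast_pow n)).trans (zero_mul _))
    have h2 : ((z (n + 1) - z n : ℤ) : ULift.{u} (ZMod (p ^ n))) = 0 := by
      apply specFun_injective
      rw [map_intCast, map_zero, Int.cast_sub, sub_eq_zero]
      exact h1.symm.trans (hz n)
    have h3 : ((z (n + 1) - z n : ℤ) : ZMod (p ^ n)) = 0 := by
      have := congrArg ULift.ringEquiv h2
      rwa [map_intCast, map_zero] at this
    have := (ZMod.intCast_zmod_eq_zero_iff_dvd _ _).mp h3
    exact_mod_cast this
  refine ⟨a, fun U => sub_eq_zero.mp ?_⟩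
  -- On `U` itself `p` is only locally nilpotent. On an affine piece `p ^ n = 0` for some `n`, and
  -- both functions become `z n`.
  let 𝒰 := Scheme.affineCover U.obj
  refine eq_zero_of_cover p (R := Sieve.generate 𝒰.presieve₀)
    (Scheme.zariskiTopology_le_fpqcTopology _ (Precoverage.generate_mem_toGrothendieck 𝒰.mem₀)) ?_
  rintro _ _ ⟨_, f, _, ⟨i⟩, rfl⟩
  have hi : IsPNilpotent p (𝒰.X i) := U.property.of_hom (𝒰.f i)
  obtain ⟨n, hn⟩ := hi.isNilpotent
  rw [Scheme.Hom.comp_appTop]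
  refine (congrArg f.appTop.hom ?_).trans (map_zero f.appTop.hom)
  have h1 : (𝒰.f i).appTop (s.1 U) = s.1 ⟨𝒰.X i, hi⟩ :=
    s.2 (show (⟨𝒰.X i, hi⟩ : SpfZp.{u} p) ⟶ U from ⟨𝒰.f i⟩)
  obtain ⟨b, hb⟩ := ha n
  refine (map_sub (𝒰.f i).appTop.hom _ _).trans (sub_eq_zero.mpr (h1.trans ?_))
  rw [key n ⟨𝒰.X i, hi⟩ hn, eq_add_of_sub_eq hb]
  have : ((𝒰.f i).appTop.hom.comp (padicIntToSections p U.property)) ((p : ℤ_[p]) ^ n * b + z n) =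
      (z n : Γ(𝒰.X i, ⊤)) := by
    rw [map_add, map_mul, map_pow, map_natCast, map_intCast, hn, zero_mul, zero_add]
  exact this.symm

/-- The canonical homomorphism `ℤ_p → H⁰(Σ, 𝒪_Σ)` is surjective. -/
lemma padicIntToSigma_surjective : Function.Surjective (padicIntToSigma.{u} p) := by
  intro s
  let s' : globalFunctions (SpfZp.toScheme.{u} p) :=
    ⟨fun S => s.1 ((sigmaPointP p).obj S), fun S' S f => s.2 ((sigmaPointP p).map f)⟩
  obtain ⟨a, ha⟩ := exists_eq_padicIntToSections s'
  refine ⟨a, (sub_eq_zero.mp (globalFunctions_eq_zero fun S => ?_)).symm⟩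
  exact sub_eq_zero.mpr (ha S)

end SpfZpFunctions

end Prismatization

open Prismatization in
theorem corollaryc (p : ℕ) [Fact p.Prime] :
    (∀ Y : ClosedSubstack (SigmaStack.toScheme.{u} p),
      Y.FactorsThrough (sigmaPointP.{u} p) → Y.mem = ⊤) ∧
    Function.Bijective (padicIntToSigma.{u} p) := by
  exact ⟨mem_eq_top_of_factorsThrough, padicIntToSigma_injective, padicIntToSigma_surjective⟩
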